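/- For every $k\ge 1$ let $\mathcal S_k$ be a finite nonempty set, let $A_k$ be a real matrix indexed by $\mathcal S_k\times\mathcal S_k$ with nonnegative off-diagonal entries, and let $D_k$ be a nonnegative real matrix indexed by $\mathcal S_k\times\mathcal S_{k+1}$, such that $A_k\mathbf 1+D_k\mathbf 1=\mathbf 0$ and all states of $\mathcal S_k$ are transient, i.e. $e^{A_kt}\to 0$ as $t\to\infty$. Let $\boldsymbol\alpha$ be a probability vector on $\mathcal S_1$. For $n\ge 1$ let $\varphi^{(n)}$ be a Markov jump process on $\{\star\}\cup\mathcal S_1\cup\dots\cup\mathcal S_n$ that starts in $\mathcal S_1$ according to $\boldsymbol\alpha$; its transition rates inside $\mathcal S_k$ are given by $A_k$, those from $\mathcal S_k$ to $\mathcal S_{k+1}$ ($k<n$) by $D_k$, those from $\mathcal S_n$ to $\star$ by $D_n\mathbf 1$, all other rates between distinct states are $0$, and $\star$ is absorbing. Let $Y_1,Y_2,\dots$ be random variables such that, for every $n\ge 1$, $$(Y_1,\dots,Y_n)\stackrel{d}{=}\Big(\int_0^\infty \mathbf 1\{\varphi^{(n)}(s)\in\mathcal S_k\}\,ds\Big)_{1\le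 k\le n}.$$ Let $u\ge 0$, $c>0$, and let $\{N(t)\mid t\ge 0\}$ be a Poisson process of intensity $\lambda>0$ such that, for every $n\ge 1$, $(Y_1,\dots,Y_n)$ is independent of $\{N(t)\}$. Assume that there are $p\in\mathbb N$, $\nu<\infty$ and $\sigma>0$ such that (A1) $|\mathcal S_k|\le p$ for all $k\ge 1$; (A2) $(-A_k\mathbf 1)_i\le\nu$ for all $k\ge 1$ and $i\in\mathcal S_k$; (A3) for all $k\ge1$, the dominant eigenvalue of $A_k$ (the eigenvalue with the largest real part) is at most $-\sigma$. Let $\{L_k\}_{k\ge 1}$ be an i.i.d. sequence of exponential random variables with rate $\nu$ and $\{H_k\}_{k\ge 1}$ an i.i.d. sequence of Erlang random variables with $p$ stages of rate $\sigma$ (density $\sigma^p x^{p-1}e^{-\sigma x}/(p-1)!$ on $[0,\infty)$), each of the two sequences being independent of $\{N(t)\}$. Put $$R(t)=u+ct-\sum_{k=1}^{N(t)}Y_k,\qquad R_L(t)=u+ct-\sum_{k=1}^{N(t)}L_k,\qquad R_H(t)=u+ct-\sum_{k=1}^{N(t)}H_k .$$ Then $$\mathbb P\Big(\inf_{t\ge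 0}R_L(t)<0\Big)\;\le\;\mathbb P\Big(\inf_{t\ge 0}R(t)<0\Big)\;\le\;\mathbb P\Big(\inf_{t\ge 0}R_H(t)<0\Big).$$ -/

import Mathlib

open MeasureTheory ProbabilityTheory Filter Topology
open scoped NNReal ENNReal Matrix

noncomputable section

/-! ### Markov jump processes on a finite state space -/

/-- `φ` is a time-homogeneous Markov jump process on the finite set `E`, under the probability
measure `P`, with generator `Λ` and initial distribution `π₀`: its finite-dimensional
distributions are given by `π₀` and by the transition semigroup `exp (t Λ)`, and almost every path
is right-continuous with left limits for the discrete topology of `E`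
(that is, piecewise constant). -/
structure IsMarkovJumpProcess {E Ω : Type*} [Fintype E] [DecidableEq E] [MeasurableSpace Ω]
    (Λ : Matrix E E ℝ) (π₀ : E → ℝ) (φ : ℝ≥0 → Ω → E) (P : Measure Ω) : Prop where
  measurableSet_eq : ∀ (t : ℝ≥0) (i : E), MeasurableSet {ω | φ t ω = i}
  right_continuous : ∀ᵐ ω ∂P, ∀ t : ℝ≥0, ∀ᶠ s in 𝓝[≥] t, φ s ω = φ t ω
  left_limits : ∀ᵐ ω ∂P, ∀ t : ℝ≥0, ∃ i : E, ∀ᶠ s in 𝓝[<] t, φ s ω = i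
  finite_dim : ∀ (n : ℕ) (t : ℕ → ℝ≥0) (x : ℕ → E), Monotone t → t 0 = 0 →
    P.real {ω | ∀ j ≤ n, φ (t j) ω = x j} =
      π₀ (x 0) * ∏ j ∈ Finset.range n,
        NormedSpace.exp (((t (j + 1) : ℝ) - (t j : ℝ)) • Λ) (x j) (x (j + 1))

/-! ### Dependent phase-type claims -/

/-- The parameters of a sequence of dependent phase-type claims. The blocks `S₁, S₂, …` of
transient states are indexed from `0`: the `k`-th block is `Fin (dim k)`. The process starts in
the block `0` according to `α`; `A k` holds the rates inside the block `k` and `D k` the rates from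
the block `k` to the next one. -/
structure PhaseTypeRep where
  dim : ℕ → ℕ
  α : Fin (dim 0) → ℝ
  A : ∀ k, Matrix (Fin (dim k)) (Fin (dim k)) ℝ
  D : ∀ k, Matrix (Fin (dim k)) (Fin (dim (k + 1))) ℝ
  α_nonneg : ∀ i, 0 ≤ α i
  α_sum : ∑ i, α i = 1
  A_nonneg : ∀ k i j, i ≠ j → 0 ≤ A k i j
  D_nonneg : ∀ k i j, 0 ≤ D k i j
  /-- The rows of the generator sum to zero. -/
  row_sum : ∀ k i, ∑ j, A k i j + ∑ j, D k i j = 0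
  /-- All states of every block are transient: since a block is never re-entered, this says that
  the process almost surely leaves it. -/
  transient : ∀ k i j, Tendsto (fun t : ℝ => NormedSpace.exp (t • A k) i j) atTop (𝓝 0)

namespace PhaseTypeRep

/-- The state space `{⋆} ∪ S₁ ∪ ⋯ ∪ Sₙ`; the absorbing state `⋆` is `none`, and `some ⟨k, i⟩` is
the state `i` of the block `k`. -/
abbrev State (M : PhaseTypeRep) (n : ℕ) : Type := Option (Σ k : Fin n, Fin (M.dim k))

/-- The generator on `{⋆} ∪ S₁ ∪ ⋯ ∪ Sₙ`: the rates `A k` inside a block, the rates `D k` from a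
block to the next one, and the row sums of the last `D` as the rates of absorption. -/
def generator (M : PhaseTypeRep) (n : ℕ) : Matrix (M.State n) (M.State n) ℝ
  | none, _ => 0
  | some ⟨k, i⟩, none => if (k : ℕ) + 1 = n then ∑ j, M.D k i j else 0
  | some ⟨k, i⟩, some ⟨l, j⟩ =>
      if h : (l : ℕ) = k then M.A k i (Fin.cast (congrArg M.dim h) j)
      else if h : (l : ℕ) = k + 1 then M.D k i (Fin.cast (congrArg M.dim h) j)
      else 0

/-- The initial distribution `[0 | α 0 ⋯ 0]`. -/
def initial (M : PhaseTypeRep) (n : ℕ) : M.State n → ℝ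
  | none => 0
  | some ⟨k, i⟩ => if h : (k : ℕ) = 0 then M.α (Fin.cast (congrArg M.dim h) i) else 0

/-- The time `∫₀^∞ 1{φ(s) ∈ S_k} ds` that the path `φ` spends in the block `k`. -/
def timeIn (M : PhaseTypeRep) {n : ℕ} (φ : ℝ≥0 → M.State n) (k : Fin n) : ℝ≥0∞ :=
  volume {s : ℝ | 0 ≤ s ∧ ∃ i : Fin (M.dim k), φ s.toNNReal = some ⟨k, i⟩}

end PhaseTypeRep

/-- The random vector `Y = (Y₁, …, Yₙ)` follows the multivariate phase-type distribution with
representation `M`: it is distributed as the vector of the times spent in the blocks `S₁, …, Sₙ`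
by a Markov jump process with generator `M.generator n` and initial distribution `M.initial n`.
These times are almost surely finite, because all the blocks are transient. -/
def IsMultivariatePhaseType {Ω : Type*} [MeasurableSpace Ω] (M : PhaseTypeRep) (n : ℕ)
    (Y : Ω → Fin n → ℝ) (P : Measure Ω) : Prop :=
  ∃ (Ω' : Type) (_ : MeasurableSpace Ω') (P' : Measure Ω') (_ : IsProbabilityMeasure P')
    (φ : ℝ≥0 → Ω' → M.State n),
    IsMarkovJumpProcess (M.generator n) (M.initial n) φ P' ∧
    IdentDistrib Y (fun ω' k => (M.timeIn (fun s => φ s ω') k).toReal) P P'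

/-- `z` is a dominant eigenvalue of the real square matrix `B`: a (complex) eigenvalue with the
largest real part. -/
def IsDominantEigenvalue {d : ℕ} (B : Matrix (Fin d) (Fin d) ℝ) (z : ℂ) : Prop :=
  Module.End.HasEigenvalue (Matrix.toLin' (B.map Complex.ofReal)) z ∧
    ∀ w : ℂ, Module.End.HasEigenvalue (Matrix.toLin' (B.map Complex.ofReal)) w → w.re ≤ z.re

/-! ### Risk processes -/

/-- `N` is a Poisson (counting) process of intensity `lam`. The paths are monotone, so that the
difference of natural numbers is the true increment. -/
structure IsPoissonProcess {Ω : Type*} [MeasurableSpace Ω] (lam : ℝ≥0) (N : ℝ≥0 → Ω → ℕ)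
    (P : Measure Ω) : Prop where
  measurable : ∀ t, Measurable (N t)
  zero : ∀ᵐ ω ∂P, N 0 ω = 0
  monotone : ∀ᵐ ω ∂P, Monotone fun t => N t ω
  right_continuous : ∀ᵐ ω ∂P, ∀ t : ℝ≥0, ∀ᶠ s in 𝓝[≥] t, N s ω = N t ω
  indep_increments : HasIndepIncrements N P
  law_increments : ∀ s t : ℝ≥0, s ≤ t →
    HasLaw (fun ω => N t ω - N s ω) (poissonMeasure (lam * (t - s))) P

/-- The reserve `R(t) = u + c t - ∑_{k=1}^{N(t)} X_k`; the claims are indexed from `0`. -/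
def reserve {Ω : Type*} (u c : ℝ) (N : ℝ≥0 → Ω → ℕ) (X : ℕ → Ω → ℝ) (t : ℝ≥0) (ω : Ω) : ℝ :=
  u + c * t - ∑ k ∈ Finset.range (N t ω), X k ω

/-- The event of ultimate ruin `inf_{t ≥ 0} R(t) < 0`; the infimum is taken in the extended reals,
so that it makes sense for paths which are not bounded below. -/
def ultimateRuin {Ω : Type*} (R : ℝ≥0 → Ω → ℝ) : Set Ω :=
  {ω | (⨅ t : ℝ≥0, (R t ω : EReal)) < 0}

end

/-!
Given the arrivals, survival says that the partial sums of the claims stay below increasing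
barriers, so it suffices to compare the probabilities that the partial sums of `n` claims stay below
`n` increasing deterministic levels. For the phase-type claims, the first `m` of them have sum at
most `ρ` exactly when the jump process has left its first `m` blocks by time `ρ`. Seen from the
entrance into a block, the barrier event is the sojourn in that block followed by a future which
depends on the entrance state; if the future is bounded, uniformly in the entrance state, by that of
a random walk, then the sojourn may be exchanged for a step of the walk which is stochastically
comparable with it. Exchanging the blocks one at a time, the last one first, compares the claims
with i.i.d. ones. It remains to compare one sojourn with an exponential and with an Erlang variable.
The exit rates are at most `ν`, so its survival function is at least `exp (-ν t)`. For the upper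
bound, the eigenvalue assumption and a Perron-Frobenius argument provide the Erlang tail.
-/

/-! ### Exponentials of Metzler matrices -/

section MatrixExponential

variable {ι : Type*} [Fintype ι] [DecidableEq ι]

theorem exp_smul_add_smul_one (A : Matrix ι ι ℝ) (r t : ℝ) :
    NormedSpace.exp (t • (A + r • (1 : Matrix ι ι ℝ))) =
      Real.exp (t * r) • NormedSpace.exp (t • A) := by
  have exp_scalar : NormedSpace.exp ((t * r) • (1 : Matrix ι ι ℝ)) =
      Real.exp (t * r) • (1 : Matrix ι ι ℝ) := by
    rw [Matrix.smul_one_eq_diagonal, Matrix.exp_diagonal, Matrix.smul_one_eq_diagonal,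
      Real.exp_eq_exp_ℝ]
    exact congrArg Matrix.diagonal (funext fun i => Pi.coe_exp _ i)
  rw [smul_add, smul_smul, Matrix.exp_add_of_commute _ _ ((Commute.one_right _).smul_right _),
    exp_scalar, Matrix.mul_smul, mul_one]

theorem exp_add_smul (A : Matrix ι ι ℝ) (s t : ℝ) :
    NormedSpace.exp ((s + t) • A) = NormedSpace.exp (s • A) * NormedSpace.exp (t • A) := by
  rw [add_smul, Matrix.exp_add_of_commute]
  exact ((Commute.refl A).smul_left s).smul_right t

theorem commute_exp_smul (A : Matrix ι ι ℝ) (t : ℝ) : Commute A (NormedSpace.exp (t • A)) :=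
  ((Commute.refl A).smul_right t).exp_right

open scoped Matrix.Norms.Operator in
theorem exp_apply_nonneg {A : Matrix ι ι ℝ} (hA : ∀ i j, 0 ≤ A i j) (i j : ι) :
    0 ≤ NormedSpace.exp A i j := by
  have hasSum : HasSum (fun n : ℕ => ((n.factorial : ℝ)⁻¹ • A ^ n) i j) (NormedSpace.exp A i j) :=
    Pi.hasSum.1 (Pi.hasSum.1 (NormedSpace.exp_series_hasSum_exp' (𝕂 := ℝ) A) i) j
  exact hasSum.nonneg fun n =>
    mul_nonneg (by positivity) (Matrix.pow_apply_nonneg hA n i j)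

open scoped Matrix.Norms.Operator in
theorem hasDerivAt_exp_smul_apply (A : Matrix ι ι ℝ) (t : ℝ) (i j : ι) :
    HasDerivAt (fun s : ℝ => NormedSpace.exp (s • A) i j)
      ((A * NormedSpace.exp (t • A)) i j) t :=
  hasDerivAt_pi.1 (hasDerivAt_pi.1 (hasDerivAt_exp_smul_const' A t) i) j

theorem hasDerivAt_exp_smul_mulVec {A : Matrix ι ι ℝ} (a : ℝ) {s : ℝ} {f : ℝ → ι → ℝ} {f' : ι → ℝ}
    (hf : HasDerivAt f f' s) :
    HasDerivAt (fun x : ℝ => NormedSpace.exp ((x - a) • A) *ᵥ f x)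
      (NormedSpace.exp ((s - a) • A) *ᵥ (A *ᵥ f s + f')) s := by
  refine hasDerivAt_pi.2 fun i => ?_
  have entry : ∀ j, HasDerivAt (fun x : ℝ => NormedSpace.exp ((x - a) • A) i j * f x j)
      ((A * NormedSpace.exp ((s - a) • A)) i j * f s j
        + NormedSpace.exp ((s - a) • A) i j * f' j) s := fun j =>
    ((hasDerivAt_exp_smul_apply A (s - a) i j).comp_sub_const s a).mul (hasDerivAt_pi.1 hf j)
  refine (HasDerivAt.fun_sum (u := Finset.univ) fun j _ => entry j).congr_deriv ?_
  rw [Finset.sum_add_distrib, Matrix.mulVec_add, Matrix.mulVec_mulVec, (commute_exp_smul A _).eq]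
  rfl

theorem hasDerivAt_exp_smul_mulVec_const (A : Matrix ι ι ℝ) (v : ι → ℝ) (t : ℝ) :
    HasDerivAt (fun s : ℝ => NormedSpace.exp (s • A) *ᵥ v)
      (A *ᵥ (NormedSpace.exp (t • A) *ᵥ v)) t := by
  have := hasDerivAt_exp_smul_mulVec (A := A) 0 (hasDerivAt_const t v)
  simpa only [sub_zero, add_zero, Matrix.mulVec_mulVec, (commute_exp_smul A t).eq] using this

theorem continuous_exp_smul_mulVec (A : Matrix ι ι ℝ) (v : ι → ℝ) :
    Continuous fun t : ℝ => NormedSpace.exp (t • A) *ᵥ v :=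
  continuous_iff_continuousAt.2 fun t => (hasDerivAt_exp_smul_mulVec_const A v t).continuousAt

theorem exp_smul_apply_eq_zero_of_lt {α : Type*} [LinearOrder α] {A : Matrix ι ι ℝ} {β : ι → α}
    (hβ : A.BlockTriangular β) (t : ℝ) {i j : ι} (hji : β j < β i) :
    NormedSpace.exp (t • A) i j = 0 :=
  Matrix.BlockTriangular.exp (fun k l hlk => by rw [Matrix.smul_apply, hβ hlk, smul_zero]) hji

end MatrixExponential

/-- A Metzler matrix: the entries off the diagonal are nonnegative. These are the matrices whose
exponentials `exp (t A)`, `t ≥ 0`, preserve the order of vectors. -/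
def IsMetzler {ι : Type*} (A : Matrix ι ι ℝ) : Prop :=
  ∀ i j, i ≠ j → 0 ≤ A i j

namespace IsMetzler

theorem exists_add_smul_one_nonneg {ι : Type*} [Finite ι] [DecidableEq ι] {A : Matrix ι ι ℝ}
    (hA : IsMetzler A) : ∃ r : ℝ, ∀ i j, 0 ≤ (A + r • (1 : Matrix ι ι ℝ)) i j := by
  obtain ⟨r, hr⟩ := (Set.finite_range fun k => -A k k).bddAbove
  refine ⟨r, fun i j => ?_⟩
  rw [Matrix.add_apply, Matrix.smul_apply, smul_eq_mul]
  rcases eq_or_ne i j with rfl | hij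
  · have : -A i i ≤ r := hr ⟨i, rfl⟩
    rw [Matrix.one_apply_eq, mul_one]
    linarith
  · rw [Matrix.one_apply_ne hij, mul_zero, add_zero]
    exact hA i j hij

variable {ι α : Type*} [Fintype ι] [DecidableEq ι] [LinearOrder α] {A : Matrix ι ι ℝ} {β : ι → α}

theorem exp_smul_apply_nonneg (hA : IsMetzler A) {t : ℝ} (ht : 0 ≤ t) (i j : ι) :
    0 ≤ NormedSpace.exp (t • A) i j := by
  obtain ⟨r, hr⟩ := hA.exists_add_smul_one_nonneg
  have h := exp_apply_nonneg (A := t • (A + r • (1 : Matrix ι ι ℝ)))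
    (fun i j => mul_nonneg ht (hr i j)) i j
  rw [exp_smul_add_smul_one, Matrix.smul_apply, smul_eq_mul] at h
  exact nonneg_of_mul_nonneg_right h (Real.exp_pos _)

theorem exp_smul_mulVec_nonneg_of_blockTriangular (hA : IsMetzler A) (hβ : A.BlockTriangular β)
    {t : ℝ} (ht : 0 ≤ t) {v : ι → ℝ} {i : ι} (hv : ∀ j, β i ≤ β j → 0 ≤ v j) :
    0 ≤ (NormedSpace.exp (t • A) *ᵥ v) i := by
  refine Finset.sum_nonneg fun j _ => ?_
  rcases le_or_gt (β i) (β j) with hij | hji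
  · exact mul_nonneg (hA.exp_smul_apply_nonneg ht i j) (hv j hij)
  · exact (mul_eq_zero_of_left (exp_smul_apply_eq_zero_of_lt hβ t hji) _).ge

theorem exp_smul_mulVec_mono_of_blockTriangular (hA : IsMetzler A) (hβ : A.BlockTriangular β)
    {t : ℝ} (ht : 0 ≤ t) {v w : ι → ℝ} {i : ι} (hvw : ∀ j, β i ≤ β j → v j ≤ w j) :
    (NormedSpace.exp (t • A) *ᵥ v) i ≤ (NormedSpace.exp (t • A) *ᵥ w) i := by
  rw [← sub_nonneg, ← Pi.sub_apply, ← Matrix.mulVec_sub]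
  exact hA.exp_smul_mulVec_nonneg_of_blockTriangular hβ ht fun j hij => sub_nonneg.2 (hvw j hij)

theorem exp_smul_mulVec_nonneg (hA : IsMetzler A) {t : ℝ} (ht : 0 ≤ t) {v : ι → ℝ}
    (hv : ∀ j, 0 ≤ v j) (i : ι) : 0 ≤ (NormedSpace.exp (t • A) *ᵥ v) i :=
  Finset.sum_nonneg fun j _ => mul_nonneg (hA.exp_smul_apply_nonneg ht i j) (hv j)

theorem exp_smul_mulVec_mono (hA : IsMetzler A) {t : ℝ} (ht : 0 ≤ t) {v w : ι → ℝ}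
    (hvw : ∀ j, v j ≤ w j) (i : ι) :
    (NormedSpace.exp (t • A) *ᵥ v) i ≤ (NormedSpace.exp (t • A) *ᵥ w) i :=
  Finset.sum_le_sum fun j _ => mul_le_mul_of_nonneg_left (hvw j) (hA.exp_smul_apply_nonneg ht i j)

theorem le_exp_smul_mulVec_of_blockTriangular (hA : IsMetzler A) (hβ : A.BlockTriangular β)
    {a b : ℝ} (hab : a ≤ b) {f f' : ℝ → ι → ℝ} (hf : ∀ s ∈ Set.Icc a b, HasDerivAt f (f' s) s)
    {i : ι} (hsub : ∀ s ∈ Set.Icc a b, ∀ j, β i ≤ β j → 0 ≤ (A *ᵥ f s) j + f' s j) :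
    f a i ≤ (NormedSpace.exp ((b - a) • A) *ᵥ f b) i := by
  have hderiv := fun s hs => hasDerivAt_pi.1 (hasDerivAt_exp_smul_mulVec (A := A) a (hf s hs)) i
  have hmono : MonotoneOn (fun x => (NormedSpace.exp ((x - a) • A) *ᵥ f x) i) (Set.Icc a b) :=
    monotoneOn_of_hasDerivWithinAt_nonneg (convex_Icc a b)
      (fun s hs => (hderiv s hs).continuousAt.continuousWithinAt)
      (fun s hs => (hderiv s (interior_subset hs)).hasDerivWithinAt)
      fun s hs => hA.exp_smul_mulVec_nonneg_of_blockTriangular hβ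
        (sub_nonneg.2 (interior_subset hs).1) (hsub s (interior_subset hs))
  simpa using hmono (Set.left_mem_Icc.2 hab) (Set.right_mem_Icc.2 hab) hab

theorem exp_smul_mulVec_le_of_blockTriangular (hA : IsMetzler A) (hβ : A.BlockTriangular β)
    {a b : ℝ} (hab : a ≤ b) {f f' : ℝ → ι → ℝ} (hf : ∀ s ∈ Set.Icc a b, HasDerivAt f (f' s) s)
    {i : ι} (hsuper : ∀ s ∈ Set.Icc a b, ∀ j, β i ≤ β j → (A *ᵥ f s) j + f' s j ≤ 0) :
    (NormedSpace.exp ((b - a) • A) *ᵥ f b) i ≤ f a i := by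
  have h := hA.le_exp_smul_mulVec_of_blockTriangular hβ hab (f := fun s => -f s)
    (f' := fun s => -f' s) (fun s hs => (hf s hs).neg) (i := i) fun s hs j hij => by
      rw [Matrix.mulVec_neg, Pi.neg_apply, Pi.neg_apply]
      linarith [hsuper s hs j hij]
  simpa only [Matrix.mulVec_neg, Pi.neg_apply, neg_le_neg_iff] using h

theorem exp_smul_mulVec_le_of_forward (hA : IsMetzler A) {b : ℝ} (hb : 0 ≤ b) {f f' : ℝ → ι → ℝ}
    (hf : ∀ s ∈ Set.Icc 0 b, HasDerivAt f (f' s) s)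
    (hsuper : ∀ s ∈ Set.Icc 0 b, ∀ i, (A *ᵥ f s) i ≤ f' s i) (i : ι) :
    (NormedSpace.exp (b • A) *ᵥ f 0) i ≤ f b i := by
  have reflect_mem : ∀ s ∈ Set.Icc 0 b, b - s ∈ Set.Icc 0 b := fun s hs =>
    ⟨sub_nonneg.2 hs.2, sub_le_self b hs.1⟩
  have h := hA.exp_smul_mulVec_le_of_blockTriangular (β := fun _ => 0)
    (fun _ _ h => absurd h (lt_irrefl 0)) hb (f := fun s => f (b - s))
    (f' := fun s => -f' (b - s)) (fun s hs => (hf _ (reflect_mem s hs)).comp_const_sub b s)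
    (i := i) fun s hs j _ => by
      rw [Pi.neg_apply]
      linarith [hsuper _ (reflect_mem s hs) j]
  simpa using h

theorem exp_neg_mul_le_exp_smul_mulVec_one (hA : IsMetzler A) {ν : ℝ}
    (hν : ∀ i, -(A *ᵥ 1) i ≤ ν) {t : ℝ} (ht : 0 ≤ t) (i : ι) :
    Real.exp (-(ν * t)) ≤ (NormedSpace.exp (t • A) *ᵥ 1) i := by
  have hderiv : ∀ s ∈ Set.Icc 0 t, HasDerivAt (fun s (_ : ι) => Real.exp (ν * (s - t)))
      (fun _ => Real.exp (ν * (s - t)) * ν) s := fun s _ => hasDerivAt_pi.2 fun _ => by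
    simpa using (((hasDerivAt_id s).sub_const t).const_mul ν).exp
  have h := hA.le_exp_smul_mulVec_of_blockTriangular (β := fun _ => 0)
    (fun _ _ h => absurd h (lt_irrefl 0)) ht hderiv (i := i) fun s _ j _ => by
      have : (fun _ : ι => Real.exp (ν * (s - t))) = Real.exp (ν * (s - t)) • 1 := by ext; simp
      rw [this, Matrix.mulVec_smul, Pi.smul_apply, smul_eq_mul]
      nlinarith [hν j, Real.exp_pos (ν * (s - t))]
  have terminal : (fun _ : ι => Real.exp (ν * (t - t))) = 1 := by ext; simp
  rwa [terminal, sub_zero, zero_sub, mul_neg] at h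

end IsMetzler

/-! ### The Erlang bound -/

/-- The partial sum `∑_{k < d} (σ t)^k / k!` of the exponential series: `e^{-σ t}` times it is the
tail of the Erlang distribution with `d` stages of rate `σ`. -/
noncomputable def expPartialSum (σ : ℝ) (d : ℕ) (t : ℝ) : ℝ :=
  ∑ k ∈ Finset.range d, (σ * t) ^ k / (k.factorial : ℝ)

theorem expPartialSum_succ (σ : ℝ) (d : ℕ) (t : ℝ) :
    expPartialSum σ (d + 1) t = expPartialSum σ d t + (σ * t) ^ d / (d.factorial : ℝ) :=
  Finset.sum_range_succ ..

theorem expPartialSum_succ_zero (σ : ℝ) (d : ℕ) : expPartialSum σ (d + 1) 0 = 1 := by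
  simp [expPartialSum, Finset.sum_range_succ']

theorem continuous_expPartialSum (σ : ℝ) (d : ℕ) : Continuous (expPartialSum σ d) := by
  unfold expPartialSum
  fun_prop

theorem expPartialSum_mono {σ t : ℝ} (hσ : 0 ≤ σ) (ht : 0 ≤ t) {d p : ℕ} (h : d ≤ p) :
    expPartialSum σ d t ≤ expPartialSum σ p t :=
  Finset.sum_le_sum_of_subset_of_nonneg (Finset.range_mono h) fun _ _ _ => by positivity

theorem one_le_expPartialSum_succ {σ t : ℝ} (hσ : 0 ≤ σ) (ht : 0 ≤ t) (d : ℕ) :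
    1 ≤ expPartialSum σ (d + 1) t := by
  simpa [expPartialSum] using expPartialSum_mono hσ ht (Nat.le_add_left 1 d)

theorem hasDerivAt_expPartialSum_succ (σ : ℝ) (d : ℕ) (t : ℝ) :
    HasDerivAt (expPartialSum σ (d + 1)) (σ * expPartialSum σ d t) t := by
  induction d with
  | zero =>
    have hone : expPartialSum σ (0 + 1) = fun _ => 1 := funext fun t => by simp [expPartialSum]
    simpa [hone, expPartialSum] using hasDerivAt_const t (1 : ℝ)
  | succ d ih =>
    have term : HasDerivAt (fun t : ℝ => (σ * t) ^ (d + 1) / ((d + 1).factorial : ℝ))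
        (σ * ((σ * t) ^ d / (d.factorial : ℝ))) t := by
      have := (((hasDerivAt_id t).const_mul σ).pow (d + 1)).div_const ((d + 1).factorial : ℝ)
      refine this.congr_deriv ?_
      rw [Nat.factorial_succ]
      push_cast
      field_simp
      simp
    rw [funext (expPartialSum_succ σ (d + 1)), expPartialSum_succ, mul_add]
    exact ih.add term

theorem one_add_mul_integral_expPartialSum (σ : ℝ) (d : ℕ) (t : ℝ) :
    1 + σ * ∫ s in (0 : ℝ)..t, expPartialSum σ d s = expPartialSum σ (d + 1) t := by
  rw [← intervalIntegral.integral_const_mul, intervalIntegral.integral_eq_sub_of_hasDerivAt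
    (fun s _ => hasDerivAt_expPartialSum_succ σ d s)
    ((continuous_const.mul (continuous_expPartialSum σ d)).intervalIntegrable _ _),
    expPartialSum_succ_zero, add_sub_cancel]

/-- The principal submatrix obtained by deleting the row and the column of `i`; the induction
proving the Erlang bound removes one state at a time. -/
def eraseIndex {ι : Type*} (M : Matrix ι ι ℝ) (i : ι) : Matrix {j // j ≠ i} {j // j ≠ i} ℝ :=
  M.submatrix Subtype.val Subtype.val

theorem isMetzler_eraseIndex {ι : Type*} {M : Matrix ι ι ℝ} (hM : IsMetzler M) (i : ι) :
    IsMetzler (eraseIndex M i) := fun _ _ hkl => hM _ _ fun h => hkl (Subtype.ext h)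

section Growth

variable {ι : Type*} [Fintype ι] [DecidableEq ι]

theorem mulVec_apply_eq_eraseIndex_add (M : Matrix ι ι ℝ) (i : ι) (w : ι → ℝ) (k : {j // j ≠ i}) :
    (M *ᵥ w) k = (eraseIndex M i *ᵥ fun l => w l) k + M k i * w i := by
  have := Finset.sum_erase_add Finset.univ (fun j => M k j * w j) (Finset.mem_univ i)
  rw [Finset.sum_subtype (Finset.univ.erase i) (p := (· ≠ i)) (by simp)
    (fun j => M k j * w j)] at this
  exact this.symm

theorem mulVec_integral_exp_smul_mulVec (M : Matrix ι ι ℝ) (v : ι → ℝ) (t : ℝ) :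
    M *ᵥ (∫ x in (0 : ℝ)..t, NormedSpace.exp (x • M) *ᵥ v) =
      NormedSpace.exp (t • M) *ᵥ v - v := by
  have hcont := continuous_exp_smul_mulVec M v
  let L : (ι → ℝ) →L[ℝ] (ι → ℝ) := M.mulVecLin.toContinuousLinearMap
  calc M *ᵥ (∫ x in (0 : ℝ)..t, NormedSpace.exp (x • M) *ᵥ v)
      = ∫ x in (0 : ℝ)..t, M *ᵥ (NormedSpace.exp (x • M) *ᵥ v) :=
        (L.intervalIntegral_comp_comm (hcont.intervalIntegrable 0 t)).symm
    _ = NormedSpace.exp (t • M) *ᵥ v - v := by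
        rw [intervalIntegral.integral_eq_sub_of_hasDerivAt
          (fun x _ => hasDerivAt_exp_smul_mulVec_const M v x)
          ((L.continuous.comp hcont).intervalIntegrable 0 t)]
        simp

theorem integral_exp_smul_mulVec_apply (M : Matrix ι ι ℝ) (v : ι → ℝ) (t : ℝ) (i : ι) :
    (∫ x in (0 : ℝ)..t, NormedSpace.exp (x • M) *ᵥ v) i =
      ∫ x in (0 : ℝ)..t, (NormedSpace.exp (x • M) *ᵥ v) i :=
  ((ContinuousLinearMap.proj (R := ℝ) (φ := fun _ : ι => ℝ) i).intervalIntegral_comp_comm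
    ((continuous_exp_smul_mulVec M v).intervalIntegrable 0 t)).symm

theorem IsMetzler.exp_smul_mulVec_one_le_of_eraseIndex {M : Matrix ι ι ℝ} (hM : IsMetzler M)
    {σ : ℝ} (hrow : ∀ j, (M *ᵥ 1) j ≤ σ) (i : ι)
    (hi : ∀ t : ℝ, 0 ≤ t → (NormedSpace.exp (t • M) *ᵥ 1) i ≤ 1) {t : ℝ} (ht : 0 ≤ t)
    (j : {j // j ≠ i}) :
    (NormedSpace.exp (t • M) *ᵥ 1) j ≤
      1 + σ * ∫ s in (0 : ℝ)..t, (NormedSpace.exp (s • eraseIndex M i) *ᵥ 1) j := by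
  set M' := eraseIndex M i
  set I : ℝ → {j // j ≠ i} → ℝ := fun s => ∫ x in (0 : ℝ)..s, NormedSpace.exp (x • M') *ᵥ 1
  let gap : ℝ → {j // j ≠ i} → ℝ := fun s => 1 + σ • I s -
    fun k : {j // j ≠ i} => (NormedSpace.exp (s • M) *ᵥ 1) k
  let gap' : ℝ → {j // j ≠ i} → ℝ := fun s =>
    σ • (NormedSpace.exp (s • M') *ᵥ 1) -
      fun k : {j // j ≠ i} => (M *ᵥ (NormedSpace.exp (s • M) *ᵥ 1)) k
  have hderiv : ∀ s ∈ Set.Icc 0 t, HasDerivAt gap (gap' s) s := fun s _ =>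
    ((((continuous_exp_smul_mulVec M' 1).integral_hasStrictDerivAt 0 s).hasDerivAt.const_smul
      σ).const_add 1).sub (hasDerivAt_pi.2 fun k : {j // j ≠ i} =>
        hasDerivAt_pi.1 (hasDerivAt_exp_smul_mulVec_const M 1 s) k)
  have hsuper : ∀ s ∈ Set.Icc 0 t, ∀ k, (M' *ᵥ gap s) k ≤ gap' s k := fun s hs k => by
    have hone : (M *ᵥ 1) k = (M' *ᵥ 1) k + M k i * 1 := mulVec_apply_eq_eraseIndex_add M i 1 k
    have hk := hrow k
    have hki := mul_le_mul_of_nonneg_left (hi s hs.1) (hM k i k.2)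
    simp only [gap, gap', I, Matrix.mulVec_sub, Matrix.mulVec_add, Matrix.mulVec_smul,
      mulVec_integral_exp_smul_mulVec, mulVec_apply_eq_eraseIndex_add M i, Pi.sub_apply,
      Pi.add_apply, Pi.smul_apply, Pi.one_apply, smul_eq_mul]
    linarith
  have hgap := (isMetzler_eraseIndex hM i).exp_smul_mulVec_le_of_forward ht hderiv hsuper j
  have hgap0 : gap 0 = 0 := by ext k; simp [gap, I]
  rw [hgap0, Matrix.mulVec_zero] at hgap
  simpa [gap, I, integral_exp_smul_mulVec_apply] using hgap

theorem IsMetzler.exp_smul_mulVec_one_le_one_of_isMin {M : Matrix ι ι ℝ} (hM : IsMetzler M)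
    {v : ι → ℝ} (hMv : ∀ j, (M *ᵥ v) j ≤ 0) {i : ι} (hi : 0 < v i) (hmin : ∀ j, v i ≤ v j)
    {t : ℝ} (ht : 0 ≤ t) : (NormedSpace.exp (t • M) *ᵥ 1) i ≤ 1 := by
  have hle : v i * (NormedSpace.exp (t • M) *ᵥ 1) i ≤ v i * 1 :=
    calc v i * (NormedSpace.exp (t • M) *ᵥ 1) i
        = (NormedSpace.exp (t • M) *ᵥ (v i • 1)) i := by
          rw [Matrix.mulVec_smul, Pi.smul_apply, smul_eq_mul]
      _ ≤ (NormedSpace.exp (t • M) *ᵥ v) i :=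
          hM.exp_smul_mulVec_mono ht (fun j => by simpa using hmin j) i
      _ ≤ v i := hM.exp_smul_mulVec_le_of_forward ht (fun s _ => hasDerivAt_const s v)
          (fun _ _ => hMv) i
      _ = v i * 1 := (mul_one _).symm
  exact le_of_mul_le_mul_left hle hi

/-- At the state where `v` is smallest the total mass never exceeds `1`, so that state can be
deleted at the cost of one integration. -/
theorem IsMetzler.exp_smul_mulVec_one_le_expPartialSum {M : Matrix ι ι ℝ} (hM : IsMetzler M)
    {σ : ℝ} (hσ : 0 ≤ σ) (hrow : ∀ j, (M *ᵥ 1) j ≤ σ) {v : ι → ℝ} (hv : ∀ j, 0 < v j)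
    (hMv : ∀ j, (M *ᵥ v) j ≤ 0) {t : ℝ} (ht : 0 ≤ t) (j : ι) :
    (NormedSpace.exp (t • M) *ᵥ 1) j ≤ expPartialSum σ (Fintype.card ι) t := by
  induction hd : Fintype.card ι generalizing ι t with
  | zero => exact ((Fintype.card_eq_zero_iff.1 hd).false j).elim
  | succ d ih =>
    have : Nonempty ι := ⟨j⟩
    obtain ⟨i, hmin⟩ := Finite.exists_min v
    have hi : ∀ t : ℝ, 0 ≤ t → (NormedSpace.exp (t • M) *ᵥ 1) i ≤ 1 := fun t ht =>
      hM.exp_smul_mulVec_one_le_one_of_isMin hMv (hv i) hmin ht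
    rcases eq_or_ne j i with rfl | hji
    · exact (hi t ht).trans (one_le_expPartialSum_succ hσ ht d)
    have row_le : ∀ (w : ι → ℝ) (k : {j // j ≠ i}), 0 ≤ w i →
        (eraseIndex M i *ᵥ fun l => w l) k ≤ (M *ᵥ w) k := fun w k hw => by
      rw [mulVec_apply_eq_eraseIndex_add]
      exact le_add_of_nonneg_right (mul_nonneg (hM k i k.2) hw)
    have hdelete : ∀ s ∈ Set.Icc 0 t,
        (NormedSpace.exp (s • eraseIndex M i) *ᵥ 1) ⟨j, hji⟩ ≤ expPartialSum σ d s :=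
      fun s hs => ih (isMetzler_eraseIndex hM i) (fun k => (row_le 1 k zero_le_one).trans (hrow k))
        (fun k => hv k) (fun k => (row_le v k (hv i).le).trans (hMv k)) hs.1 _
        (by simp [Fintype.card_subtype_compl, hd])
    calc (NormedSpace.exp (t • M) *ᵥ 1) j
        ≤ 1 + σ * ∫ s in (0 : ℝ)..t,
            (NormedSpace.exp (s • eraseIndex M i) *ᵥ 1) ⟨j, hji⟩ :=
          hM.exp_smul_mulVec_one_le_of_eraseIndex hrow i hi ht ⟨j, hji⟩
      _ ≤ 1 + σ * ∫ s in (0 : ℝ)..t, expPartialSum σ d s := by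
          gcongr
          exact intervalIntegral.integral_mono_on ht
            ((continuous_pi_iff.1 (continuous_exp_smul_mulVec _ 1) _).intervalIntegrable 0 t)
            ((continuous_expPartialSum σ d).intervalIntegrable 0 t) hdelete
      _ = expPartialSum σ (d + 1) t := one_add_mul_integral_expPartialSum σ d t

end Growth

section PositiveVector

variable {ι : Type*} [Fintype ι] {A : Matrix ι ι ℝ}

theorem IsMetzler.mulVec_apply_le (hA : IsMetzler A) {v w : ι → ℝ} (hvw : ∀ j, v j ≤ w j) {i : ι}
    (hi : v i = w i) : (A *ᵥ v) i ≤ (A *ᵥ w) i := by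
  refine Finset.sum_le_sum fun j _ => ?_
  rcases eq_or_ne i j with rfl | hij
  · rw [hi]
  · exact mul_le_mul_of_nonneg_left (hvw j) (hA i j hij)

theorem IsMetzler.pos_of_smul_sub_mulVec_eq_one (hA : IsMetzler A) {s : ℝ} {v : ι → ℝ}
    (hv : s • v - A *ᵥ v = 1) (hv0 : ∀ j, 0 ≤ v j) (i : ι) : 0 < v i := by
  refine (hv0 i).lt_of_ne fun hi => ?_
  have hAv : (A *ᵥ 0) i ≤ (A *ᵥ v) i := hA.mulVec_apply_le hv0 hi
  have hrow : s * v i - (A *ᵥ v) i = 1 := congrFun hv i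
  rw [Matrix.mulVec_zero, Pi.zero_apply] at hAv
  rw [← hi, mul_zero] at hrow
  linarith

theorem IsMetzler.nonneg_of_smul_sub_mulVec_eq_one (hA : IsMetzler A) {s : ℝ}
    (hs : ∀ i, (A *ᵥ 1) i < s) {v : ι → ℝ} (hv : s • v - A *ᵥ v = 1) (i : ι) : 0 ≤ v i := by
  have : Nonempty ι := ⟨i⟩
  obtain ⟨k, hmin⟩ := Finite.exists_min v
  have hAv : (A *ᵥ (v k • 1)) k ≤ (A *ᵥ v) k :=
    hA.mulVec_apply_le (fun j => by simpa using hmin j) (by simp)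
  have hrow : s * v k - (A *ᵥ v) k = 1 := congrFun hv k
  rw [Matrix.mulVec_smul, Pi.smul_apply, smul_eq_mul] at hAv
  have hk : 0 ≤ v k := by nlinarith [hs k]
  exact hk.trans (hmin i)

variable [DecidableEq ι]

theorem smul_resolvent_mulVec_sub {s : ℝ} (hs : (s • (1 : Matrix ι ι ℝ) - A).det ≠ 0) (v : ι → ℝ) :
    s • ((s • (1 : Matrix ι ι ℝ) - A)⁻¹ *ᵥ v) - A *ᵥ ((s • (1 : Matrix ι ι ℝ) - A)⁻¹ *ᵥ v) = v := by
  set R := s • (1 : Matrix ι ι ℝ) - A with hR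
  calc s • (R⁻¹ *ᵥ v) - A *ᵥ (R⁻¹ *ᵥ v) = R *ᵥ (R⁻¹ *ᵥ v) := by
        rw [hR, Matrix.sub_mulVec, Matrix.smul_mulVec, Matrix.one_mulVec]
    _ = v := by rw [Matrix.mulVec_mulVec, Matrix.mul_nonsing_inv _ hs.isUnit, Matrix.one_mulVec]

theorem continuousOn_resolvent_mulVec {U : Set ℝ}
    (hU : ∀ s ∈ U, (s • (1 : Matrix ι ι ℝ) - A).det ≠ 0) (v : ι → ℝ) :
    ContinuousOn (fun s : ℝ => (s • (1 : Matrix ι ι ℝ) - A)⁻¹ *ᵥ v) U := by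
  have hcont : Continuous fun s : ℝ => s • (1 : Matrix ι ι ℝ) - A := by fun_prop
  simp only [Matrix.inv_def, Ring.inverse_eq_inv', Matrix.smul_mulVec]
  exact (hcont.matrix_det.continuousOn.inv₀ hU).smul
    (hcont.matrix_adjugate.matrix_mulVec continuous_const).continuousOn

/-- For large `s` the vector `(s - A)⁻¹ 1` is positive, and it cannot leave the positive cone while
`s` decreases to `r`: at a first exit one of its coordinates would vanish. -/
theorem IsMetzler.resolvent_mulVec_one_pos (hA : IsMetzler A) {r : ℝ}
    (hdet : ∀ s ∈ Set.Ioi r, (s • (1 : Matrix ι ι ℝ) - A).det ≠ 0) {s : ℝ} (hs : r < s) (i : ι) :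
    0 < ((s • (1 : Matrix ι ι ℝ) - A)⁻¹ *ᵥ 1) i := by
  set v : ℝ → ι → ℝ := fun s => (s • (1 : Matrix ι ι ℝ) - A)⁻¹ *ᵥ 1
  have hcont : ContinuousOn v (Set.Ioi r) := continuousOn_resolvent_mulVec hdet 1
  have solves : ∀ s ∈ Set.Ioi r, s • v s - A *ᵥ v s = 1 := fun s hs =>
    smul_resolvent_mulVec_sub (hdet s hs) 1
  let V : Set ℝ := Set.Ioi r ∩ v ⁻¹' {w | ∀ j, 0 < w j}
  have hV_open : IsOpen V := hcont.isOpen_inter_preimage isOpen_Ioi <| by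
    simpa [Set.pi] using isOpen_set_pi (s := fun _ : ι => Set.Ioi (0 : ℝ)) Set.finite_univ
      fun _ _ => isOpen_Ioi
  have hV_nonempty : (Set.Ioi r ∩ V).Nonempty := by
    obtain ⟨B, hB⟩ := (Set.finite_range (A *ᵥ 1)).bddAbove
    have hmem : max r B + 1 ∈ Set.Ioi r := (le_max_left r B).trans_lt (lt_add_one _)
    refine ⟨_, hmem, hmem, hA.pos_of_smul_sub_mulVec_eq_one (solves _ hmem)
      (hA.nonneg_of_smul_sub_mulVec_eq_one (fun k => ?_) (solves _ hmem))⟩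
    exact (hB ⟨k, rfl⟩).trans_lt ((le_max_right r B).trans_lt (lt_add_one _))
  have hV_closed : closure V ∩ Set.Ioi r ⊆ V := fun s ⟨hsV, hs⟩ => by
    have hnonneg : v s ∈ {w | ∀ j, 0 ≤ w j} := by
      have hclosed : IsClosed {w : ι → ℝ | ∀ j, 0 ≤ w j} := isClosed_Ici
      exact hclosed.mem_of_frequently_of_tendsto
        ((mem_closure_iff_frequently.1 hsV).mono fun x hx j => (hx.2 j).le)
        (hcont.continuousAt (Ioi_mem_nhds hs))
    exact ⟨hs, hA.pos_of_smul_sub_mulVec_eq_one (solves s hs) hnonneg⟩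
  exact ((isPreconnected_Ioi.subset_of_closure_inter_subset hV_open hV_nonempty hV_closed) hs).2 i

theorem IsMetzler.exists_pos_mulVec_nonpos (hA : IsMetzler A) {r : ℝ}
    (hdet : ∀ s ∈ Set.Ioi r, (s • (1 : Matrix ι ι ℝ) - A).det ≠ 0) {s : ℝ} (hs : r < s) :
    ∃ v : ι → ℝ, (∀ i, 0 < v i) ∧ ∀ i, ((A - s • (1 : Matrix ι ι ℝ)) *ᵥ v) i ≤ 0 := by
  refine ⟨_, hA.resolvent_mulVec_one_pos hdet hs, fun i => ?_⟩
  rw [← neg_sub, Matrix.neg_mulVec, Matrix.mulVec_mulVec,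
    Matrix.mul_nonsing_inv _ (hdet s hs).isUnit, Matrix.one_mulVec]
  simp

end PositiveVector

theorem det_smul_one_sub_ne_zero {d : ℕ} {A : Matrix (Fin d) (Fin d) ℝ} {r : ℝ}
    (hA : ∀ z, IsDominantEigenvalue A z → z.re ≤ r) {s : ℝ} (hs : r < s) :
    (s • (1 : Matrix (Fin d) (Fin d) ℝ) - A).det ≠ 0 := by
  intro hdet
  set T := Matrix.toLin' (A.map Complex.ofReal) with hT
  have heigen : Module.End.HasEigenvalue T (s : ℂ) := by
    have hroot : A.charpoly.IsRoot s := by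
      rwa [Polynomial.IsRoot, Matrix.eval_charpoly, Matrix.scalar_apply,
        ← Matrix.smul_one_eq_diagonal]
    rw [Module.End.hasEigenvalue_iff_isRoot_charpoly, hT, Matrix.charpoly_toLin',
      show A.map Complex.ofReal = A.map Complex.ofRealHom from rfl, Matrix.charpoly_map]
    exact hroot.map (f := Complex.ofRealHom)
  obtain ⟨z, hz, hmax⟩ :=
    Set.exists_max_image _ Complex.re (Module.End.finite_hasEigenvalue T) ⟨_, heigen⟩
  have hsz : s ≤ z.re := hmax _ heigen
  linarith [hA z ⟨hz, hmax⟩]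

section ErlangBound

variable {d : ℕ} {A : Matrix (Fin d) (Fin d) ℝ}

theorem IsMetzler.exp_smul_mulVec_one_le_of_lt (hA : IsMetzler A)
    (hrow : ∀ i, (A *ᵥ 1) i ≤ 0) {σ : ℝ} (hdom : ∀ z, IsDominantEigenvalue A z → z.re ≤ -σ)
    {s : ℝ} (hs0 : 0 ≤ s) (hs : s < σ) {t : ℝ} (ht : 0 ≤ t) (i : Fin d) :
    (NormedSpace.exp (t • A) *ᵥ 1) i ≤ Real.exp (-(s * t)) * expPartialSum s d t := by
  obtain ⟨v, hv, hAv⟩ := hA.exists_pos_mulVec_nonpos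
    (fun _ hr => det_smul_one_sub_ne_zero hdom hr) (neg_lt_neg hs)
  rw [neg_smul, sub_neg_eq_add] at hAv
  have hshift : IsMetzler (A + s • (1 : Matrix (Fin d) (Fin d) ℝ)) := fun k l hkl => by
    simpa [Matrix.one_apply_ne hkl] using hA k l hkl
  have h := hshift.exp_smul_mulVec_one_le_expPartialSum hs0 (fun k => by
    rw [Matrix.add_mulVec, Matrix.smul_mulVec, Matrix.one_mulVec]
    simpa using hrow k) hv hAv ht i
  rw [exp_smul_add_smul_one, Matrix.smul_mulVec, Pi.smul_apply, smul_eq_mul, Fintype.card_fin] at h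
  rw [Real.exp_neg, mul_comm s t]
  exact (le_inv_mul_iff₀ (Real.exp_pos _)).2 h

theorem IsMetzler.exp_smul_mulVec_one_le_erlang (hA : IsMetzler A)
    (hrow : ∀ i, (A *ᵥ 1) i ≤ 0) {σ : ℝ} (hσ : 0 < σ)
    (hdom : ∀ z, IsDominantEigenvalue A z → z.re ≤ -σ) {p : ℕ} (hdp : d ≤ p) {t : ℝ} (ht : 0 ≤ t)
    (i : Fin d) :
    (NormedSpace.exp (t • A) *ᵥ 1) i ≤ Real.exp (-(σ * t)) * expPartialSum σ p t := by
  have hcont : Continuous fun s : ℝ => Real.exp (-(s * t)) * expPartialSum s d t := by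
    unfold expPartialSum
    fun_prop
  have hle : (NormedSpace.exp (t • A) *ᵥ 1) i ≤ Real.exp (-(σ * t)) * expPartialSum σ d t := by
    refine ge_of_tendsto (hcont.continuousAt.tendsto.mono_left nhdsWithin_le_nhds :
      Tendsto _ (𝓝[<] σ) _) ?_
    filter_upwards [Ioo_mem_nhdsLT hσ] with s hs
    exact hA.exp_smul_mulVec_one_le_of_lt hrow hdom hs.1.le hs.2 ht i
  exact hle.trans (mul_le_mul_of_nonneg_left (expPartialSum_mono hσ.le ht hdp) (Real.exp_pos _).le)

end ErlangBound

/-! ### Stochastic order and survival probabilities -/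

/-- The usual stochastic order between laws of real random variables: `κ` is below `μ` when it puts
at least as much mass on every half-line `(-∞, a]`. -/
def StochasticallyLE (κ μ : Measure ℝ) : Prop :=
  ∀ a, μ (Set.Iic a) ≤ κ (Set.Iic a)

namespace StochasticallyLE

variable {κ μ : Measure ℝ}

theorem of_forall_nonneg (hμ : μ (Set.Iio 0) = 0)
    (h : ∀ a, 0 ≤ a → μ (Set.Iic a) ≤ κ (Set.Iic a)) : StochasticallyLE κ μ := fun a => by
  rcases le_or_gt 0 a with ha | ha
  · exact h a ha
  · exact (measure_mono_null (Set.Iic_subset_Iio.2 ha) hμ).trans_le zero_le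

theorem measure_le_of_isLowerSet (h : StochasticallyLE κ μ) {S : Set ℝ} (hS : IsLowerSet S) :
    μ S ≤ κ S := by
  by_cases hmax : ∃ a, IsGreatest S a
  · obtain ⟨a, haS, ha⟩ := hmax
    rw [show S = Set.Iic a from Set.Subset.antisymm ha (hS.Iic_subset haS)]
    exact h a
  · have hunion : S = ⋃ q : {q : ℚ // (q : ℝ) ∈ S}, Set.Iic (q : ℝ) := by
      refine Set.Subset.antisymm (fun x hx => ?_) (Set.iUnion_subset fun q => hS.Iic_subset q.2)
      have hx' : ¬IsGreatest S x := fun hg => hmax ⟨x, hg⟩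
      obtain ⟨y, hy, hxy⟩ : ∃ y ∈ S, x < y := by
        simpa [IsGreatest, hx, upperBounds] using hx'
      obtain ⟨q, hxq, hqy⟩ := exists_rat_btwn hxy
      exact Set.mem_iUnion.2 ⟨⟨q, hS hqy.le hy⟩, hxq.le⟩
    have hdir : Directed (· ⊆ ·) fun q : {q : ℚ // (q : ℝ) ∈ S} => Set.Iic (q : ℝ) :=
      Monotone.directed_le fun _ _ hqq' => Set.Iic_subset_Iic.2 (by exact_mod_cast hqq')
    rw [hunion, hdir.measure_iUnion, hdir.measure_iUnion]
    exact iSup_mono fun q => h q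

theorem integral_le_of_antitone (h : StochasticallyLE κ μ) {v : ℝ → ℝ} (hv : Antitone v)
    (hv0 : ∀ x, 0 ≤ v x) (hint : Integrable v κ) : ∫ x, v x ∂μ ≤ ∫ x, v x ∂κ := by
  have hm := hv.measurable
  rw [integral_eq_lintegral_of_nonneg_ae (ae_of_all _ hv0) hm.aestronglyMeasurable,
    integral_eq_lintegral_of_nonneg_ae (ae_of_all _ hv0) hm.aestronglyMeasurable]
  refine ENNReal.toReal_mono hint.lintegral_lt_top.ne ?_
  rw [lintegral_eq_lintegral_meas_lt κ (ae_of_all _ hv0) hm.aemeasurable,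
    lintegral_eq_lintegral_meas_lt μ (ae_of_all _ hv0) hm.aemeasurable]
  exact lintegral_mono fun y => h.measure_le_of_isLowerSet fun _ _ hab ha => ha.trans_le (hv hab)

end StochasticallyLE

/-- A survival function: a nonincreasing function with values in `[0, 1]`. The survival
probabilities below are such functions of the starting time. -/
structure IsSurvivalFunction (w : ℝ → ℝ) : Prop where
  antitone : Antitone w
  nonneg : ∀ t, 0 ≤ w t
  le_one : ∀ t, w t ≤ 1

/-- The probability that a step of law `μ`, started at the time `t`, ends before the barrier `a`
and that an event of conditional probability `w` then occurs, `w` being a function of the end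
time of the step. -/
noncomputable def stepSurvival (μ : Measure ℝ) (a : ℝ) (w : ℝ → ℝ) (t : ℝ) : ℝ :=
  ∫ x, (Set.Iic a).indicator w (t + x) ∂μ

/-- The probability that the partial sums `t + X₀ + ⋯ + Xⱼ`, `j < m`, of a random walk with step
law `μ` stay below the barriers `r (k + j)`. -/
noncomputable def walkSurvival (μ : Measure ℝ) (r : ℕ → ℝ) : ℕ → ℕ → ℝ → ℝ
  | _, 0 => 1
  | k, m + 1 => stepSurvival μ (r k) (walkSurvival μ r (k + 1) m)

theorem stepSurvival_eq_setIntegral (μ : Measure ℝ) (a : ℝ) (w : ℝ → ℝ) (t : ℝ) :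
    stepSurvival μ a w t = ∫ x in Set.Iic (a - t), w (t + x) ∂μ := by
  rw [stepSurvival, ← integral_indicator measurableSet_Iic]
  congr 1 with x
  simp only [Set.indicator_apply, Set.mem_Iic, le_sub_iff_add_le']

namespace IsSurvivalFunction

variable {w : ℝ → ℝ}

theorem indicator_Iic (hw : IsSurvivalFunction w) (a : ℝ) :
    IsSurvivalFunction ((Set.Iic a).indicator w) where
  antitone x y hxy := by
    by_cases hy : y ≤ a
    · simpa [hy, hxy.trans hy] using hw.antitone hxy
    · simpa [hy] using Set.indicator_nonneg (fun t _ => hw.nonneg t) x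
  nonneg := Set.indicator_nonneg fun t _ => hw.nonneg t
  le_one _ := Set.indicator_apply_le' (fun _ => hw.le_one _) fun _ => zero_le_one

theorem comp_const_add (hw : IsSurvivalFunction w) (t : ℝ) :
    IsSurvivalFunction fun x => w (t + x) where
  antitone _ _ hxy := hw.antitone (by gcongr)
  nonneg _ := hw.nonneg _
  le_one _ := hw.le_one _

theorem norm_le_one (hw : IsSurvivalFunction w) (t : ℝ) : ‖w t‖ ≤ 1 := by
  rw [Real.norm_of_nonneg (hw.nonneg t)]
  exact hw.le_one t

theorem integrable (hw : IsSurvivalFunction w) (μ : Measure ℝ) [IsFiniteMeasure μ] :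
    Integrable w μ :=
  .of_bound hw.antitone.measurable.aestronglyMeasurable 1 (ae_of_all _ hw.norm_le_one)

theorem integrable_indicator_comp_add (hw : IsSurvivalFunction w) (μ : Measure ℝ)
    [IsFiniteMeasure μ] (a t : ℝ) : Integrable (fun x => (Set.Iic a).indicator w (t + x)) μ :=
  ((hw.indicator_Iic a).comp_const_add t).integrable μ

theorem isSurvivalFunction_stepSurvival (hw : IsSurvivalFunction w) (μ : Measure ℝ)
    [IsProbabilityMeasure μ] (a : ℝ) : IsSurvivalFunction (stepSurvival μ a w) where
  antitone s t hst := integral_mono (hw.integrable_indicator_comp_add μ a t)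
    (hw.integrable_indicator_comp_add μ a s) fun _ => (hw.indicator_Iic a).antitone (by gcongr)
  nonneg t := integral_nonneg fun _ => (hw.indicator_Iic a).nonneg _
  le_one t := by
    simpa [stepSurvival] using
      integral_mono (hw.integrable_indicator_comp_add μ a t) (integrable_const (1 : ℝ))
        fun _ => (hw.indicator_Iic a).le_one _

theorem continuous_stepSurvival (hw : IsSurvivalFunction w) (hc : Continuous w) (μ : Measure ℝ)
    [IsFiniteMeasure μ] [NullSingletonClass μ] (a : ℝ) :
    Continuous (stepSurvival μ a w) := by
  refine continuous_iff_continuousAt.2 fun t => ?_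
  refine continuousAt_of_dominated (bound := fun _ => (1 : ℝ))
    (.of_forall fun s => (hw.integrable_indicator_comp_add μ a s).aestronglyMeasurable)
    (.of_forall fun s => ae_of_all _ fun x => (hw.indicator_Iic a).norm_le_one _)
    (integrable_const _) ?_
  have hne : ∀ᵐ x ∂μ, x ≠ a - t := by simp [ae_iff]
  filter_upwards [hne] with x hx
  have hfrontier : t + x ∉ frontier (Set.Iic a) := by
    rw [frontier_Iic, Set.mem_singleton_iff]
    exact fun h => hx (eq_sub_of_add_eq' h)
  exact (hc.continuousOn.continuousAt_indicator hfrontier).comp (f := fun s => s + x)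
    (continuous_add_const x).continuousAt

theorem stepSurvival_mono {κ μ : Measure ℝ} [IsFiniteMeasure κ] (hw : IsSurvivalFunction w)
    (h : StochasticallyLE κ μ) (a t : ℝ) :
    stepSurvival μ a w t ≤ stepSurvival κ a w t :=
  have hv := (hw.indicator_Iic a).comp_const_add t
  h.integral_le_of_antitone hv.antitone hv.nonneg (hv.integrable κ)

end IsSurvivalFunction

section WalkSurvival

variable (μ : Measure ℝ) [IsProbabilityMeasure μ]

theorem isSurvivalFunction_walkSurvival (r : ℕ → ℝ) (k m : ℕ) :
    IsSurvivalFunction (walkSurvival μ r k m) := by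
  induction m generalizing k with
  | zero => exact ⟨fun _ _ _ => le_rfl, fun _ => zero_le_one, fun _ => le_rfl⟩
  | succ m ih => exact (ih (k + 1)).isSurvivalFunction_stepSurvival μ (r k)

theorem continuous_walkSurvival [NullSingletonClass μ] (r : ℕ → ℝ) (k m : ℕ) :
    Continuous (walkSurvival μ r k m) := by
  induction m generalizing k with
  | zero => exact continuous_const
  | succ m ih =>
    exact (isSurvivalFunction_walkSurvival μ r (k + 1) m).continuous_stepSurvival (ih (k + 1)) μ _

theorem tendsto_walkSurvival_const (k m : ℕ) (t : ℝ) :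
    Tendsto (fun a : ℝ => walkSurvival μ (fun _ => a) k m t) atTop (𝓝 1) := by
  induction m generalizing k t with
  | zero => exact tendsto_const_nhds
  | succ m ih =>
    have hw := fun a : ℝ => isSurvivalFunction_walkSurvival μ (fun _ => a) (k + 1) m
    have h := tendsto_integral_filter_of_dominated_convergence (μ := μ) (l := atTop)
      (F := fun (a : ℝ) x =>
        (Set.Iic a).indicator (walkSurvival μ (fun _ => a) (k + 1) m) (t + x))
      (fun _ => 1) (.of_forall fun a =>
        ((hw a).integrable_indicator_comp_add μ a t).aestronglyMeasurable)
      (.of_forall fun a => ae_of_all _ fun x => ((hw a).indicator_Iic a).norm_le_one _)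
      (integrable_const 1) (ae_of_all _ fun x => (ih (k + 1) (t + x)).congr' ?_)
    · simpa [walkSurvival, stepSurvival] using h
    · filter_upwards [eventually_ge_atTop (t + x)] with a ha
      simp [ha]

end WalkSurvival

/-- The vectors whose partial sums `y₀ + ⋯ + yⱼ` stay below the barriers `r j`. -/
def barrierSet (r : ℕ → ℝ) (n : ℕ) : Set (Fin n → ℝ) :=
  {y | ∀ j : Fin n, ∑ i ∈ Finset.Iic j, y i ≤ r j}

theorem measurableSet_barrierSet (r : ℕ → ℝ) (n : ℕ) : MeasurableSet (barrierSet r n) := by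
  simp only [barrierSet, Set.ofPred_forall]
  exact MeasurableSet.iInter fun j => measurableSet_le (by fun_prop) measurable_const

theorem mem_barrierSet_nat {r x : ℕ → ℝ} {n : ℕ} :
    (fun k : Fin n => x k) ∈ barrierSet r n ↔
      ∀ m < n, ∑ k ∈ Finset.range (m + 1), x k ≤ r m := by
  have hsum (j : Fin n) : ∑ i ∈ Finset.Iic j, x i = ∑ k ∈ Finset.range (j + 1), x k := by
    rw [Nat.range_succ_eq_Iic, ← Fin.map_valEmbedding_Iic, Finset.sum_map]
    rfl
  simp only [barrierSet, Set.mem_ofPred_eq, hsum, Fin.forall_iff]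

theorem mem_barrierSet_succ {r : ℕ → ℝ} {n : ℕ} {y : Fin (n + 1) → ℝ} :
    y ∈ barrierSet r (n + 1) ↔
      y 0 ≤ r 0 ∧ Fin.tail y ∈ barrierSet (fun j => r (j + 1) - y 0) n := by
  simp [barrierSet, Fin.forall_fin_succ, ← Finset.filter_ge_eq_Iic, Finset.sum_filter,
    Fin.sum_univ_succ, le_sub_iff_add_le', Fin.tail]

theorem pi_barrierSet_eq_walkSurvival (μ : Measure ℝ) [IsProbabilityMeasure μ] (r : ℕ → ℝ)
    (k m : ℕ) (t : ℝ) :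
    Measure.pi (fun _ : Fin m => μ) (barrierSet (fun j => r (k + j) - t) m) =
      ENNReal.ofReal (walkSurvival μ r k m t) := by
  induction m generalizing k t with
  | zero => simp [barrierSet, walkSurvival]
  | succ m ih =>
    have hw := isSurvivalFunction_walkSurvival μ r (k + 1) m
    have hsplit := (measurePreserving_piFinSuccAbove (fun _ : Fin (m + 1) => μ) 0).symm
    rw [← hsplit.measure_preimage_equiv, Measure.prod_apply
      (hsplit.measurable (measurableSet_barrierSet _ _)), walkSurvival, stepSurvival,
      ofReal_integral_eq_lintegral_ofReal (hw.integrable_indicator_comp_add μ _ _)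
        (ae_of_all _ fun x => (hw.indicator_Iic _).nonneg _)]
    refine lintegral_congr fun x => ?_
    have hpre : Prod.mk x ⁻¹' ((MeasurableEquiv.piFinSuccAbove (fun _ => ℝ) 0).symm ⁻¹'
        barrierSet (fun j => r (k + j) - t) (m + 1)) =
        {y | t + x ≤ r k ∧ y ∈ barrierSet (fun j => r (k + 1 + j) - (t + x)) m} := by
      ext y
      simp [mem_barrierSet_succ, MeasurableEquiv.piFinSuccAbove, Fin.consEquiv, sub_sub,
        le_sub_iff_add_le', add_assoc, add_comm 1]
    rw [hpre]
    by_cases hx : t + x ≤ r k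
    · simpa [hx] using ih (k + 1) (t + x)
    · simp [hx]

theorem measure_barrierSet_eq_walkSurvival {Ω : Type*} [MeasurableSpace Ω] {P : Measure Ω}
    [IsProbabilityMeasure P] {μ : Measure ℝ} {X : ℕ → Ω → ℝ} (hlaw : ∀ k, HasLaw (X k) μ P)
    (hX : iIndepFun X P) (r : ℕ → ℝ) (n : ℕ) :
    P {ω | (fun k : Fin n => X k ω) ∈ barrierSet r n} =
      ENNReal.ofReal (walkSurvival μ r 0 n 0) := by
  have : IsProbabilityMeasure μ := (hlaw 0).isProbabilityMeasure_iff.1 ‹_›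
  have hm (k : Fin n) : AEMeasurable (X k) P := (hlaw k).aemeasurable
  have hmap := (hX.precomp Fin.val_injective).map_fun_eq_pi_map hm
  simp only [(hlaw _).map_eq] at hmap
  have hpi := pi_barrierSet_eq_walkSurvival μ r 0 n 0
  rw [← hmap, Measure.map_apply_of_aemeasurable (aemeasurable_pi_lambda _ hm)
    (measurableSet_barrierSet _ _)] at hpi
  simp only [zero_add, sub_zero] at hpi
  exact hpi

/-! ### Sojourn times in a block -/

theorem hasDerivAt_neg_exp_mul_expPartialSum (σ : ℝ) (d : ℕ) (x : ℝ) :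
    HasDerivAt (fun x => -(Real.exp (-(σ * x)) * expPartialSum σ (d + 1) x))
      (σ ^ (d + 1) / (d.factorial : ℝ) * x ^ d * Real.exp (-(σ * x))) x := by
  have hexp : HasDerivAt (fun x : ℝ => Real.exp (-(σ * x))) (Real.exp (-(σ * x)) * -σ) x := by
    simpa using (((hasDerivAt_id x).const_mul σ).neg).exp
  refine (hexp.mul (hasDerivAt_expPartialSum_succ σ d x)).neg.congr_deriv ?_
  rw [expPartialSum_succ]
  ring

theorem gammaPDFReal_nat_of_nonneg (d : ℕ) (σ : ℝ) {x : ℝ} (hx : 0 ≤ x) :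
    gammaPDFReal ((d + 1 : ℕ) : ℝ) σ x =
      σ ^ (d + 1) / (d.factorial : ℝ) * x ^ d * Real.exp (-(σ * x)) := by
  have hpow : (((d + 1 : ℕ) : ℝ) - 1) = (d : ℝ) := by push_cast; ring
  rw [gammaPDFReal, if_pos hx, hpow, Real.rpow_natCast, Real.rpow_natCast, Nat.cast_succ,
    Real.Gamma_nat_eq_factorial]

theorem gammaMeasure_nat_real_Iic {p : ℕ} (hp : 0 < p) {σ : ℝ} (hσ : 0 < σ) {a : ℝ} (ha : 0 ≤ a) :
    (gammaMeasure p σ).real (Set.Iic a) = 1 - Real.exp (-(σ * a)) * expPartialSum σ p a := by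
  obtain ⟨d, rfl⟩ := Nat.exists_eq_add_one_of_ne_zero hp.ne'
  have hp' : (0 : ℝ) < ((d + 1 : ℕ) : ℝ) := by positivity
  have := isProbabilityMeasure_gammaMeasure hp' hσ
  have hneg : ∀ x ∈ Set.Iic a \ Set.Icc 0 a, gammaPDFReal ((d + 1 : ℕ) : ℝ) σ x = 0 :=
    fun x hx => if_neg fun hx0 => hx.2 ⟨hx0, hx.1⟩
  rw [← cdf_eq_real, cdf_gammaMeasure_eq_integral hp' hσ,
    setIntegral_eq_of_subset_of_forall_sdiff_eq_zero measurableSet_Iic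
      Set.Icc_subset_Iic_self hneg,
    setIntegral_congr_fun measurableSet_Icc fun x hx => gammaPDFReal_nat_of_nonneg d σ hx.1,
    integral_Icc_eq_integral_Ioc, ← intervalIntegral.integral_of_le ha,
    intervalIntegral.integral_eq_sub_of_hasDerivAt
      (fun x _ => hasDerivAt_neg_exp_mul_expPartialSum σ d x)
      (Continuous.intervalIntegrable (by fun_prop) _ _)]
  simp only [expPartialSum_succ_zero, mul_zero, neg_zero, Real.exp_zero, mul_one]
  ring

instance nullSingletonClass_gammaMeasure (a r : ℝ) : NullSingletonClass (gammaMeasure a r) where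
  measure_singleton x := withDensity_absolutelyContinuous _ _ (measure_singleton x)

theorem gammaMeasure_Iio_zero (a r : ℝ) : gammaMeasure a r (Set.Iio 0) = 0 := by
  rw [gammaMeasure, withDensity_apply _ measurableSet_Iio]
  exact lintegral_gammaPDF_of_nonpos le_rfl

section SojournLaw

variable {ι : Type*} [Fintype ι] [DecidableEq ι] {A : Matrix ι ι ℝ}

/-- The law of the time that a Markov jump process spends in a block with rates `A`, when it starts
in the state `i` of the block: its density on `(0, ∞)` is `exp (x A) (-A 1)` at `i`, because
`-A 1` holds the rates of leaving the block. -/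
noncomputable def sojournLaw (A : Matrix ι ι ℝ) (i : ι) : Measure ℝ :=
  (volume.restrict (Set.Ioi 0)).withDensity fun x =>
    ENNReal.ofReal ((NormedSpace.exp (x • A) *ᵥ (-(A *ᵥ 1))) i)

theorem continuous_sojournDensity (A : Matrix ι ι ℝ) (i : ι) :
    Continuous fun x : ℝ => (NormedSpace.exp (x • A) *ᵥ (-(A *ᵥ 1))) i :=
  continuous_pi_iff.1 (continuous_exp_smul_mulVec A _) i

theorem integral_sojournDensity (A : Matrix ι ι ℝ) (i : ι) (a : ℝ) :
    ∫ x in (0 : ℝ)..a, (NormedSpace.exp (x • A) *ᵥ (-(A *ᵥ 1))) i =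
      1 - (NormedSpace.exp (a • A) *ᵥ 1) i := by
  have hderiv (x : ℝ) : HasDerivAt (fun x => -(NormedSpace.exp (x • A) *ᵥ 1) i)
      ((NormedSpace.exp (x • A) *ᵥ (-(A *ᵥ 1))) i) x := by
    refine (hasDerivAt_pi.1 (hasDerivAt_exp_smul_mulVec_const A 1 x) i).neg.congr_deriv ?_
    rw [Matrix.mulVec_mulVec, commute_exp_smul, ← Matrix.mulVec_mulVec, Matrix.mulVec_neg,
      Pi.neg_apply]
  rw [intervalIntegral.integral_eq_sub_of_hasDerivAt (fun x _ => hderiv x)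
    ((continuous_sojournDensity A i).intervalIntegrable _ _)]
  simp only [zero_smul, NormedSpace.exp_zero, Matrix.one_mulVec, Pi.one_apply]
  ring

theorem sojournLaw_Iio_zero (A : Matrix ι ι ℝ) (i : ι) : sojournLaw A i (Set.Iio 0) = 0 := by
  refine withDensity_absolutelyContinuous _ _ ?_
  rw [Measure.restrict_apply measurableSet_Iio, Set.Iio_inter_Ioi, Set.Ioo_self, measure_empty]

namespace IsMetzler

theorem sojournDensity_nonneg (hA : IsMetzler A) (hrow : ∀ i, (A *ᵥ 1) i ≤ 0) (i : ι) {x : ℝ}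
    (hx : 0 ≤ x) : 0 ≤ (NormedSpace.exp (x • A) *ᵥ (-(A *ᵥ 1))) i :=
  hA.exp_smul_mulVec_nonneg hx (fun j => neg_nonneg.2 (hrow j)) i

theorem sojournLaw_Iic (hA : IsMetzler A) (hrow : ∀ i, (A *ᵥ 1) i ≤ 0) (i : ι) {a : ℝ}
    (ha : 0 ≤ a) :
    sojournLaw A i (Set.Iic a) = ENNReal.ofReal (1 - (NormedSpace.exp (a • A) *ᵥ 1) i) := by
  rw [sojournLaw, withDensity_apply _ measurableSet_Iic,
    Measure.restrict_restrict measurableSet_Iic, Set.Iic_inter_Ioi,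
    ← ofReal_integral_eq_lintegral_ofReal
      (((continuous_sojournDensity A i).integrableOn_Icc).mono_set Set.Ioc_subset_Icc_self)
      (ae_restrict_of_forall_mem measurableSet_Ioc fun x hx =>
        hA.sojournDensity_nonneg hrow i hx.1.le),
    ← intervalIntegral.integral_of_le ha, integral_sojournDensity]

theorem isFiniteMeasure_sojournLaw (hA : IsMetzler A) (hrow : ∀ i, (A *ᵥ 1) i ≤ 0) (i : ι) :
    IsFiniteMeasure (sojournLaw A i) := by
  refine ⟨(le_of_tendsto (tendsto_measure_Iic_atTop _) ?_).trans_lt ENNReal.one_lt_top⟩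
  filter_upwards [eventually_ge_atTop 0] with a ha
  rw [hA.sojournLaw_Iic hrow i ha, ← ENNReal.ofReal_one]
  exact ENNReal.ofReal_le_ofReal
    (sub_le_self _ (hA.exp_smul_mulVec_nonneg ha (fun _ => zero_le_one) i))

theorem sojournLaw_stochasticallyLE_erlang {d p : ℕ} {A : Matrix (Fin d) (Fin d) ℝ}
    (hA : IsMetzler A) (hrow : ∀ i, (A *ᵥ 1) i ≤ 0) {σ : ℝ} (hσ : 0 < σ)
    (hdom : ∀ z : ℂ, IsDominantEigenvalue A z → z.re ≤ -σ) (hdp : d ≤ p) (i : Fin d) :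
    StochasticallyLE (sojournLaw A i) (gammaMeasure p σ) := by
  have hp : 0 < p := i.pos.trans_le hdp
  have := isProbabilityMeasure_gammaMeasure (Nat.cast_pos.2 hp) hσ
  refine .of_forall_nonneg (gammaMeasure_Iio_zero p σ) fun a ha => ?_
  rw [hA.sojournLaw_Iic hrow i ha, ← ofReal_measureReal, gammaMeasure_nat_real_Iic hp hσ ha]
  exact ENNReal.ofReal_le_ofReal
    (sub_le_sub_left (hA.exp_smul_mulVec_one_le_erlang hrow hσ hdom hdp ha i) 1)

theorem exponential_stochasticallyLE_sojournLaw (hA : IsMetzler A) (hrow : ∀ i, (A *ᵥ 1) i ≤ 0)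
    {ν : ℝ} (hν : 0 < ν) (hexit : ∀ i, -(A *ᵥ 1) i ≤ ν) (i : ι) :
    StochasticallyLE (expMeasure ν) (sojournLaw A i) := by
  have := isProbabilityMeasure_expMeasure hν
  refine .of_forall_nonneg (sojournLaw_Iio_zero A i) fun a ha => ?_
  rw [hA.sojournLaw_Iic hrow i ha, ← ofReal_measureReal, ← cdf_eq_real, cdf_expMeasure_eq hν,
    if_pos ha]
  exact ENNReal.ofReal_le_ofReal
    (sub_le_sub_left (hA.exp_neg_mul_le_exp_smul_mulVec_one hexit ha i) 1)

end IsMetzler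

/-- The vector `∫ₜʳ exp ((x - t) A) (-A 1) w x dx`: for `t ≤ r`, the probability that a block with
rates `A`, entered at the time `t`, is left before the barrier `r` and that an event of conditional
probability `w` occurs afterwards. Unlike `stepSurvival (sojournLaw A i) r w`, it is differentiable
in `t` at the barrier. -/
noncomputable def blockSurvival (A : Matrix ι ι ℝ) (r : ℝ) (w : ℝ → ℝ) (t : ℝ) : ι → ℝ :=
  NormedSpace.exp ((-t) • A) *ᵥ
    fun j => ∫ x in t..r, (NormedSpace.exp (x • A) *ᵥ (-(A *ᵥ 1))) j * w x

theorem blockSurvival_self (A : Matrix ι ι ℝ) (r : ℝ) (w : ℝ → ℝ) :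
    blockSurvival A r w r = 0 := by
  simp only [blockSurvival, intervalIntegral.integral_same]
  exact Matrix.mulVec_zero _

theorem hasDerivAt_blockSurvival (A : Matrix ι ι ℝ) (r : ℝ) {w : ℝ → ℝ} (hw : Continuous w)
    (t : ℝ) : HasDerivAt (blockSurvival A r w)
      (-(A *ᵥ blockSurvival A r w t) + w t • (A *ᵥ 1)) t := by
  have htail : HasDerivAt
      (fun s j => ∫ x in s..r, (NormedSpace.exp (x • A) *ᵥ (-(A *ᵥ 1))) j * w x)
      (w t • (NormedSpace.exp (t • A) *ᵥ (A *ᵥ 1))) t := by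
    refine hasDerivAt_pi.2 fun j => ?_
    have hc : Continuous fun x : ℝ => (NormedSpace.exp (x • A) *ᵥ (-(A *ᵥ 1))) j * w x :=
      (continuous_sojournDensity A j).mul hw
    refine (intervalIntegral.integral_hasDerivAt_left (hc.intervalIntegrable _ _)
      (hc.stronglyMeasurableAtFilter _ _) hc.continuousAt).congr_deriv ?_
    simp only [Matrix.mulVec_neg, Pi.neg_apply, Pi.smul_apply, smul_eq_mul]
    ring
  have h := hasDerivAt_exp_smul_mulVec (A := -A) 0 htail
  simp only [sub_zero, smul_neg, ← neg_smul] at h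
  refine h.congr_deriv ?_
  have hcancel : NormedSpace.exp (-t • A) * NormedSpace.exp (t • A) = 1 := by
    rw [← exp_add_smul, neg_add_cancel, zero_smul, NormedSpace.exp_zero]
  rw [Matrix.mulVec_add, Matrix.mulVec_smul, Matrix.mulVec_mulVec (A *ᵥ 1), hcancel,
    Matrix.one_mulVec, Matrix.neg_mulVec, Matrix.mulVec_neg, Matrix.mulVec_mulVec,
    ← commute_exp_smul, ← Matrix.mulVec_mulVec, blockSurvival]

theorem blockSurvival_eq_integral (A : Matrix ι ι ℝ) (r : ℝ) {w : ℝ → ℝ} (hw : Continuous w)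
    (t : ℝ) (i : ι) : blockSurvival A r w t i =
      ∫ x in (0 : ℝ)..(r - t), (NormedSpace.exp (x • A) *ᵥ (-(A *ᵥ 1))) i * w (t + x) := by
  have hshift : ∫ x in (0 : ℝ)..(r - t), (NormedSpace.exp (x • A) *ᵥ (-(A *ᵥ 1))) i * w (t + x) =
      ∫ x in t..r, (NormedSpace.exp ((x - t) • A) *ᵥ (-(A *ᵥ 1))) i * w x := by
    simpa using intervalIntegral.integral_comp_add_left (a := 0) (b := r - t)
      (fun x => (NormedSpace.exp ((x - t) • A) *ᵥ (-(A *ᵥ 1))) i * w x) t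
  have hsplit (x : ℝ) : (NormedSpace.exp ((x - t) • A) *ᵥ (-(A *ᵥ 1))) i * w x =
      ∑ j, NormedSpace.exp ((-t) • A) i j *
        ((NormedSpace.exp (x • A) *ᵥ (-(A *ᵥ 1))) j * w x) := by
    rw [sub_eq_neg_add, exp_add_smul, ← Matrix.mulVec_mulVec, Matrix.mulVec, dotProduct,
      Finset.sum_mul]
    exact Finset.sum_congr rfl fun j _ => mul_assoc _ _ _
  simp only [hshift, hsplit]
  rw [intervalIntegral.integral_finsetSum (f := fun j x => NormedSpace.exp ((-t) • A) i j *
    ((NormedSpace.exp (x • A) *ᵥ (-(A *ᵥ 1))) j * w x)) fun j _ => (continuous_const.mul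
      ((continuous_sojournDensity A j).mul hw)).intervalIntegrable _ _]
  simp only [intervalIntegral.integral_const_mul]
  rfl

theorem IsMetzler.blockSurvival_eq_stepSurvival (hA : IsMetzler A) (hrow : ∀ i, (A *ᵥ 1) i ≤ 0)
    {r : ℝ} {w : ℝ → ℝ} (hw : Continuous w) {t : ℝ} (ht : t ≤ r) (i : ι) :
    blockSurvival A r w t i = stepSurvival (sojournLaw A i) r w t := by
  rw [blockSurvival_eq_integral A r hw, stepSurvival_eq_setIntegral, sojournLaw,
    setIntegral_withDensity_eq_setIntegral_toReal_smul
      (continuous_sojournDensity A i).measurable.ennreal_ofReal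
      (ae_of_all _ fun _ => ENNReal.ofReal_lt_top) _ measurableSet_Iic,
    Measure.restrict_restrict measurableSet_Iic, Set.Iic_inter_Ioi,
    intervalIntegral.integral_of_le (sub_nonneg.2 ht)]
  refine setIntegral_congr_fun measurableSet_Ioc fun x hx => ?_
  simp only [ENNReal.toReal_ofReal (hA.sojournDensity_nonneg hrow i hx.1.le), smul_eq_mul]

end SojournLaw

/-! ### Finite-dimensional distributions of Markov jump processes -/

/-- The event that the process is in the states `x 0, …, x j` at the times `t 0, …, t j`, and then
in the sets `B (j + 1), …, B (j + q)` at the times `t (j + 1), …, t (j + q)`. -/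
def pathCylinder {E Ω : Type*} (φ : ℝ≥0 → Ω → E) (t : ℕ → ℝ≥0) (x : ℕ → E) (B : ℕ → Set E)
    (j q : ℕ) : Set Ω :=
  {ω | (∀ i ≤ j, φ (t i) ω = x i) ∧ ∀ i, j < i → i ≤ j + q → φ (t i) ω ∈ B i}

theorem pathCylinder_succ_inter {E Ω : Type*} (φ : ℝ≥0 → Ω → E) (t : ℕ → ℝ≥0) (x : ℕ → E)
    (B : ℕ → Set E) (j q : ℕ) (y : E) :
    pathCylinder φ t x B j (q + 1) ∩ {ω | φ (t (j + 1)) ω = y} =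
      {ω | y ∈ B (j + 1) ∧ ω ∈ pathCylinder φ t (Function.update x (j + 1) y) B (j + 1) q} := by
  have hupdate : ∀ i ≤ j, Function.update x (j + 1) y i = x i := fun i hi =>
    Function.update_of_ne (by omega) _ _
  ext ω
  simp only [pathCylinder, Set.mem_inter_iff, Set.mem_ofPred_eq]
  constructor
  · rintro ⟨⟨hpast, hfuture⟩, rfl⟩
    refine ⟨hfuture _ (by omega) (by omega), fun i hi => ?_, fun i _ _ =>
      hfuture i (by omega) (by omega)⟩
    rcases hi.lt_or_eq with hij | rfl
    · rw [hupdate i (by omega), hpast i (by omega)]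
    · rw [Function.update_self]
  · rintro ⟨hy, hpast, hfuture⟩
    have hnow : φ (t (j + 1)) ω = y := by rw [hpast _ le_rfl, Function.update_self]
    refine ⟨⟨fun i hi => by rw [hpast i (by omega), hupdate i hi], fun i hji hi => ?_⟩, hnow⟩
    rcases (Nat.succ_le_of_lt hji).lt_or_eq with h | rfl
    · exact hfuture i h (by omega)
    · exact hnow ▸ hy

section MarkovJumpProcess

variable {E : Type*} [Fintype E] [DecidableEq E]

/-- The probability that a Markov jump process with generator `Λ`, in a given state at the time
`t j`, is in the sets `B (j + 1), …, B (j + q)` at the times `t (j + 1), …, t (j + q)`. -/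
noncomputable def backwardProb (Λ : Matrix E E ℝ) (t : ℕ → ℝ) (B : ℕ → Set E) : ℕ → ℕ → E → ℝ
  | _, 0 => 1
  | j, q + 1 => NormedSpace.exp ((t (j + 1) - t j) • Λ) *ᵥ
      (B (j + 1)).indicator (backwardProb Λ t B (j + 1) q)

namespace IsMarkovJumpProcess

variable {Ω : Type*} [MeasurableSpace Ω] {P : Measure Ω} [IsProbabilityMeasure P]
  {Λ : Matrix E E ℝ} {π₀ : E → ℝ} {φ : ℝ≥0 → Ω → E}

theorem measureReal_eq_sum_inter (h : IsMarkovJumpProcess Λ π₀ φ P) (t : ℝ≥0) (S : Set Ω) :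
    P.real S = ∑ y, P.real (S ∩ {ω | φ t ω = y}) := by
  have hsum := sum_measureReal_preimage_singleton (μ := P.restrict S) Finset.univ (f := φ t)
    fun y _ => h.measurableSet_eq t y
  rw [Finset.coe_univ, Set.preimage_univ, measureReal_restrict_apply_univ] at hsum
  rw [← hsum]
  refine Finset.sum_congr rfl fun y _ => ?_
  exact (measureReal_restrict_apply (h.measurableSet_eq t y)).trans (by rw [Set.inter_comm])

theorem measureReal_pathCylinder (h : IsMarkovJumpProcess Λ π₀ φ P) {t : ℕ → ℝ≥0}
    (ht : Monotone t) (ht0 : t 0 = 0) (B : ℕ → Set E) (q j : ℕ) (x : ℕ → E) :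
    P.real (pathCylinder φ t x B j q) =
      (π₀ (x 0) * ∏ i ∈ Finset.range j,
        NormedSpace.exp (((t (i + 1) : ℝ) - (t i : ℝ)) • Λ) (x i) (x (i + 1))) *
        backwardProb Λ (fun i => t i) B j q (x j) := by
  induction q generalizing j x with
  | zero =>
    have hfuture : pathCylinder φ t x B j 0 = {ω | ∀ i ≤ j, φ (t i) ω = x i} := by
      ext ω
      refine and_iff_left fun i hji hi => absurd hi (by omega)
    rw [hfuture, h.finite_dim j t x ht ht0, backwardProb, Pi.one_apply, mul_one]
  | succ q ih =>
    rw [h.measureReal_eq_sum_inter (t (j + 1)), backwardProb, Matrix.mulVec, dotProduct,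
      Finset.mul_sum]
    refine Finset.sum_congr rfl fun y _ => ?_
    have hupdate : ∀ i ≤ j, Function.update x (j + 1) y i = x i := fun i hi =>
      Function.update_of_ne (by omega) _ _
    have hprod : ∏ i ∈ Finset.range j, NormedSpace.exp (((t (i + 1) : ℝ) - (t i : ℝ)) • Λ)
        (Function.update x (j + 1) y i) (Function.update x (j + 1) y (i + 1)) =
        ∏ i ∈ Finset.range j, NormedSpace.exp (((t (i + 1) : ℝ) - (t i : ℝ)) • Λ)
          (x i) (x (i + 1)) := Finset.prod_congr rfl fun i hi => by
      rw [hupdate i (Finset.mem_range.1 hi).le, hupdate (i + 1) (Finset.mem_range.1 hi)]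
    rw [pathCylinder_succ_inter]
    by_cases hy : y ∈ B (j + 1)
    · simp only [hy, true_and, Set.ofPred_mem_eq, ih, Set.indicator_of_mem]
      rw [Finset.prod_range_succ, hprod, hupdate 0 j.zero_le, hupdate j le_rfl,
        Function.update_self]
      ring
    · simp [hy]

theorem measureReal_forall_mem (h : IsMarkovJumpProcess Λ π₀ φ P) {t : ℕ → ℝ≥0}
    (ht : Monotone t) (ht0 : t 0 = 0) (B : ℕ → Set E) (q : ℕ) :
    P.real {ω | ∀ i, 0 < i → i ≤ q → φ (t i) ω ∈ B i} =
      ∑ x, π₀ x * backwardProb Λ (fun i => t i) B 0 q x := by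
  rw [h.measureReal_eq_sum_inter (t 0)]
  refine Finset.sum_congr rfl fun x _ => ?_
  have hstart : {ω | ∀ i, 0 < i → i ≤ q → φ (t i) ω ∈ B i} ∩ {ω | φ (t 0) ω = x} =
      pathCylinder φ t (fun _ => x) B 0 q := by
    ext ω
    simp [pathCylinder, and_comm]
  simp [hstart, h.measureReal_pathCylinder ht ht0]

theorem measure_eq_and_eq_of_exp_eq_zero (h : IsMarkovJumpProcess Λ π₀ φ P) {s t : ℝ≥0}
    (hst : s ≤ t) {x y : E} (hxy : NormedSpace.exp (((t : ℝ) - s) • Λ) x y = 0) :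
    P {ω | φ s ω = x ∧ φ t ω = y} = 0 := by
  let τ : ℕ → ℝ≥0 | 0 => 0 | 1 => s | _ => t
  let B : ℕ → Set E | 1 => {x} | _ => {y}
  have hτ : Monotone τ := monotone_nat_of_le_succ fun
    | 0 => zero_le
    | 1 => hst
    | _ + 2 => le_rfl
  have hB : (B (0 + 1)).indicator (backwardProb Λ (fun i => τ i) B (0 + 1) 1) = 0 := by
    ext z
    by_cases hz : z = x
    · simpa [B, τ, hz, backwardProb, Matrix.mulVec, dotProduct, Set.indicator_apply] using hxy
    · simp [B, hz]
  have hfidi := h.measureReal_forall_mem hτ rfl B 2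
  rw [backwardProb, hB, Matrix.mulVec_zero] at hfidi
  simp only [Pi.zero_apply, mul_zero, Finset.sum_const_zero] at hfidi
  refine measure_mono_null (fun ω hω => ?_) ((measureReal_eq_zero_iff).1 hfidi)
  intro i hi hi2
  interval_cases i
  exacts [hω.1, hω.2]

end IsMarkovJumpProcess

end MarkovJumpProcess

/-! ### The generator of the block process -/

namespace PhaseTypeRep

variable (M : PhaseTypeRep) {n : ℕ}

/-- The index of the block of a state; the absorbing state counts as the block `n`. -/
def level : M.State n → ℕ
  | none => n
  | some ⟨k, _⟩ => k

/-- The values of a function on the state space in the block `k`. The absorbing state stands for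
every block from the block `n` on, so that absorption is a transition from the block `n - 1` to the
block `n` and the rates between blocks are `D` throughout. -/
def blockPart (f : M.State n → ℝ) (k : ℕ) : Fin (M.dim k) → ℝ := fun i =>
  if h : k < n then f (some ⟨⟨k, h⟩, i⟩) else f none

theorem level_none : M.level (none : M.State n) = n := rfl

theorem level_some (k : Fin n) (i : Fin (M.dim k)) : M.level (some ⟨k, i⟩ : M.State n) = k := rfl

theorem exists_blockPart_eq {k : ℕ} (hk : k ≤ n) (i : Fin (M.dim k)) :
    ∃ x : M.State n, M.level x = k ∧ ∀ f, M.blockPart f k i = f x := by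
  rcases hk.lt_or_eq with h | rfl
  · exact ⟨some ⟨⟨k, h⟩, i⟩, rfl, fun f => dif_pos h⟩
  · exact ⟨none, rfl, fun f => dif_neg (lt_irrefl _)⟩

theorem isMetzler_A (k : ℕ) : IsMetzler (M.A k) := M.A_nonneg k

theorem A_mulVec_one (k : ℕ) : M.A k *ᵥ 1 = -(M.D k *ᵥ 1) := by
  ext i
  simpa [Matrix.mulVec, dotProduct] using eq_neg_of_add_eq_zero_left (M.row_sum k i)

theorem D_mulVec_nonneg (k : ℕ) {v : Fin (M.dim (k + 1)) → ℝ} (hv : ∀ j, 0 ≤ v j)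
    (i : Fin (M.dim k)) : 0 ≤ (M.D k *ᵥ v) i :=
  dotProduct_nonneg_of_nonneg (M.D_nonneg k i) hv

theorem A_mulVec_one_nonpos (k : ℕ) (i : Fin (M.dim k)) : (M.A k *ᵥ 1) i ≤ 0 := by
  rw [A_mulVec_one, Pi.neg_apply, neg_nonpos]
  exact M.D_mulVec_nonneg k (fun _ => zero_le_one) i

theorem isMetzler_generator (n : ℕ) : IsMetzler (M.generator n) := by
  rintro (_ | ⟨k, i⟩) (_ | ⟨l, j⟩) hne
  · exact le_rfl
  · exact le_rfl
  · simp only [generator]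
    split_ifs
    exacts [Finset.sum_nonneg fun j _ => M.D_nonneg k i j, le_rfl]
  · simp only [generator]
    split_ifs with hlk
    · obtain rfl : l = k := Fin.ext hlk
      exact M.A_nonneg _ _ _ fun h => hne (by rw [h]; rfl)
    · exact M.D_nonneg _ _ _
    · exact le_rfl

theorem blockTriangular_generator (n : ℕ) : (M.generator n).BlockTriangular M.level := by
  rintro (_ | ⟨k, i⟩) (_ | ⟨l, j⟩) hlt
  · rfl
  · rfl
  · exact absurd hlt k.2.not_gt
  · simp only [level_some] at hlt
    simp only [generator]
    rw [dif_neg (by omega), dif_neg (by omega)]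

theorem generator_mulVec_none (f : M.State n → ℝ) : (M.generator n *ᵥ f) none = 0 := by
  simp [Matrix.mulVec, dotProduct, generator]

theorem generator_mulVec_some (f : M.State n → ℝ) (k : Fin n) (i : Fin (M.dim k)) :
    (M.generator n *ᵥ f) (some ⟨k, i⟩) =
      (M.A k *ᵥ M.blockPart f k) i + (M.D k *ᵥ M.blockPart f (k + 1)) i := by
  have hstay : ∑ j, M.generator n (some ⟨k, i⟩) (some ⟨k, j⟩) * f (some ⟨k, j⟩) =
      (M.A k *ᵥ M.blockPart f k) i := by
    simp [generator, Matrix.mulVec, dotProduct, blockPart]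
  have hfar (l : Fin n) (hl : (l : ℕ) ≠ k) (hl' : (l : ℕ) ≠ k + 1) :
      ∑ j, M.generator n (some ⟨k, i⟩) (some ⟨l, j⟩) * f (some ⟨l, j⟩) = 0 := by
    simp [generator, hl, hl']
  rw [Matrix.mulVec, dotProduct, Fintype.sum_option, Fintype.sum_sigma]
  rcases (show (k : ℕ) + 1 ≤ n from k.2).lt_or_eq with hlast | hlast
  · rw [Finset.sum_eq_add k ⟨k + 1, hlast⟩ (fun h => by simpa using congrArg Fin.val h)
      (fun l _ hl => hfar l (Fin.val_ne_of_ne hl.1) (Fin.val_ne_of_ne hl.2)) (by simp) (by simp),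
      hstay]
    simp [generator, hlast, hlast.ne, Matrix.mulVec, dotProduct, blockPart]
  · rw [Finset.sum_eq_single k
      (fun l _ hl => hfar l (Fin.val_ne_of_ne hl) (by omega)) (by simp), hstay]
    simp [generator, hlast, Matrix.mulVec, dotProduct, blockPart, Finset.sum_mul, add_comm]

theorem sum_initial_mul (hn : 0 < n) (f : M.State n → ℝ) :
    ∑ x, M.initial n x * f x = ∑ i, M.α i * f (some ⟨⟨0, hn⟩, i⟩) := by
  rw [Fintype.sum_option, Fintype.sum_sigma, Finset.sum_eq_single ⟨0, hn⟩]
  · simp [initial]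
  · intro l _ hl
    simp [initial, show (l : ℕ) ≠ 0 from fun h => hl (Fin.ext h)]
  · simp

end PhaseTypeRep

/-! ### Replacing the blocks by the steps of a random walk -/

namespace PhaseTypeRep

variable (M : PhaseTypeRep) {n : ℕ}

/-- The probability of leaving the current block `k` and the later ones before their barriers, as a
function of the time and the state, when the sojourns in the blocks after `k` are replaced by the
steps of a random walk with step law `μ`. -/
noncomputable def hybridSurvival (μ : Measure ℝ) (r : ℕ → ℝ) (t : ℝ) : M.State n → ℝ
  | none => 1
  | some ⟨k, i⟩ => blockSurvival (M.A k) (r k) (walkSurvival μ r (k + 1) (n - (k + 1))) t i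

/-- The defect of `hybridSurvival` in the backward equation of the block process: the rates of
leaving the current block, weighted with the difference between the hybrid survival probability
and that of the random walk in the next block. -/
noncomputable def hybridDefect (μ : Measure ℝ) (r : ℕ → ℝ) (t : ℝ) : M.State n → ℝ
  | none => 0
  | some ⟨k, i⟩ => (M.D k *ᵥ fun j => M.blockPart (n := n) (M.hybridSurvival μ r t) (k + 1) j -
      walkSurvival μ r (k + 1) (n - (k + 1)) t) i

variable {M} {μ : Measure ℝ} {r : ℕ → ℝ}

theorem hybridSurvival_eq_zero (x : M.State n) (hx : M.level x < n) :
    M.hybridSurvival μ r (r (M.level x)) x = 0 := by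
  rcases x with _ | ⟨k, i⟩
  · exact absurd hx (lt_irrefl _)
  · exact congrFun (blockSurvival_self (M.A k) (r k) _) i

variable [IsProbabilityMeasure μ] [NullSingletonClass μ]

theorem hasDerivAt_hybridSurvival (t : ℝ) :
    HasDerivAt (M.hybridSurvival (n := n) μ r)
      (M.hybridDefect μ r t - M.generator n *ᵥ M.hybridSurvival μ r t) t := by
  refine hasDerivAt_pi.2 fun x => ?_
  rcases x with _ | ⟨k, i⟩
  · simpa [hybridSurvival, hybridDefect, generator_mulVec_none] using hasDerivAt_const t (1 : ℝ)
  · have hblock : M.blockPart (n := n) (M.hybridSurvival μ r t) k =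
        blockSurvival (M.A k) (r k) (walkSurvival μ r (k + 1) (n - (k + 1))) t := by
      ext j
      simp [blockPart, hybridSurvival]
    have hdefect (v : Fin (M.dim (k + 1)) → ℝ) (c : ℝ) :
        M.D k *ᵥ (fun j => v j - c) = M.D k *ᵥ v + c • (M.A k *ᵥ 1) := by
      rw [A_mulVec_one, smul_neg, ← sub_eq_add_neg, ← Matrix.mulVec_smul, ← Matrix.mulVec_sub]
      congr 1 with j
      simp
    refine (hasDerivAt_pi.1 (hasDerivAt_blockSurvival (M.A k) (r k)
      (continuous_walkSurvival μ r (k + 1) (n - (k + 1))) t) i).congr_deriv ?_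
    simp only [hybridDefect, Pi.sub_apply, generator_mulVec_some, hblock, hdefect, Pi.add_apply,
      Pi.neg_apply]
    ring

theorem hybridSurvival_some {t : ℝ} (k : Fin n) (ht : t ≤ r k) (i : Fin (M.dim k)) :
    M.hybridSurvival μ r t (some ⟨k, i⟩) =
      stepSurvival (sojournLaw (M.A k) i) (r k) (walkSurvival μ r (k + 1) (n - (k + 1))) t :=
  (M.isMetzler_A k).blockSurvival_eq_stepSurvival (M.A_mulVec_one_nonpos k)
    (continuous_walkSurvival μ r _ _) ht i

theorem walkSurvival_le_hybridSurvival
    (hμ : ∀ k i, StochasticallyLE (sojournLaw (M.A k) i) μ) {t : ℝ} (x : M.State n)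
    (ht : t ≤ r (M.level x)) :
    walkSurvival μ r (M.level x) (n - M.level x) t ≤ M.hybridSurvival μ r t x := by
  rcases x with _ | ⟨k, i⟩
  · exact (isSurvivalFunction_walkSurvival μ r _ _).le_one t
  · have := (M.isMetzler_A k).isFiniteMeasure_sojournLaw (M.A_mulVec_one_nonpos k) i
    rw [level_some, hybridSurvival_some k ht, show n - k = n - (k + 1) + 1 by omega]
    exact (isSurvivalFunction_walkSurvival μ r _ _).stepSurvival_mono (hμ k i) _ t

theorem hybridSurvival_le_walkSurvival
    (hμ : ∀ k i, StochasticallyLE μ (sojournLaw (M.A k) i)) {t : ℝ} (x : M.State n)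
    (ht : t ≤ r (M.level x)) :
    M.hybridSurvival μ r t x ≤ walkSurvival μ r (M.level x) (n - M.level x) t := by
  rcases x with _ | ⟨k, i⟩
  · simp [level_none, hybridSurvival, walkSurvival]
  · rw [level_some, hybridSurvival_some k ht, show n - k = n - (k + 1) + 1 by omega]
    exact (isSurvivalFunction_walkSurvival μ r _ _).stepSurvival_mono (hμ k i) _ t

theorem hybridDefect_nonneg (hμ : ∀ k i, StochasticallyLE (sojournLaw (M.A k) i) μ)
    (hr : Monotone r) {t : ℝ} (x : M.State n) (ht : t ≤ r (M.level x)) :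
    0 ≤ M.hybridDefect μ r t x := by
  rcases x with _ | ⟨k, i⟩
  · exact le_rfl
  · refine M.D_mulVec_nonneg k (fun j => sub_nonneg.2 ?_) i
    obtain ⟨y, hy, hblock⟩ := M.exists_blockPart_eq (show (k : ℕ) + 1 ≤ n from k.2) j
    rw [hblock, ← hy]
    exact walkSurvival_le_hybridSurvival hμ y (ht.trans (hr (hy ▸ Nat.le_succ _)))

theorem hybridDefect_nonpos (hμ : ∀ k i, StochasticallyLE μ (sojournLaw (M.A k) i))
    (hr : Monotone r) {t : ℝ} (x : M.State n) (ht : t ≤ r (M.level x)) :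
    M.hybridDefect μ r t x ≤ 0 := by
  rcases x with _ | ⟨k, i⟩
  · exact le_rfl
  · rw [hybridDefect, ← neg_nonneg, ← Pi.neg_apply, ← Matrix.mulVec_neg]
    refine M.D_mulVec_nonneg k (fun j => neg_nonneg.2 (sub_nonpos.2 ?_)) i
    obtain ⟨y, hy, hblock⟩ := M.exists_blockPart_eq (show (k : ℕ) + 1 ≤ n from k.2) j
    rw [hblock, ← hy]
    exact hybridSurvival_le_walkSurvival hμ y (ht.trans (hr (hy ▸ Nat.le_succ _)))

theorem hybridSurvival_le_exp_mulVec (hμ : ∀ k i, StochasticallyLE (sojournLaw (M.A k) i) μ)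
    (hr : Monotone r) {a b : ℝ} (hab : a ≤ b) (x : M.State n) (hb : b ≤ r (M.level x)) :
    M.hybridSurvival μ r a x ≤
      (NormedSpace.exp ((b - a) • M.generator n) *ᵥ M.hybridSurvival μ r b) x := by
  refine (M.isMetzler_generator n).le_exp_smul_mulVec_of_blockTriangular
    (M.blockTriangular_generator n) hab (fun s _ => hasDerivAt_hybridSurvival s) fun s hs y hy => ?_
  rw [Pi.sub_apply, add_sub_cancel]
  exact hybridDefect_nonneg hμ hr y (hs.2.trans (hb.trans (hr hy)))

theorem exp_mulVec_le_hybridSurvival (hμ : ∀ k i, StochasticallyLE μ (sojournLaw (M.A k) i))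
    (hr : Monotone r) {a b : ℝ} (hab : a ≤ b) (x : M.State n) (hb : b ≤ r (M.level x)) :
    (NormedSpace.exp ((b - a) • M.generator n) *ᵥ M.hybridSurvival μ r b) x ≤
      M.hybridSurvival μ r a x := by
  refine (M.isMetzler_generator n).exp_smul_mulVec_le_of_blockTriangular
    (M.blockTriangular_generator n) hab (fun s _ => hasDerivAt_hybridSurvival s) fun s hs y hy => ?_
  rw [Pi.sub_apply, add_sub_cancel]
  exact hybridDefect_nonpos hμ hr y (hs.2.trans (hb.trans (hr hy)))

/-- The observation times of the block process: time `0`, followed by the barriers. -/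
def barrierTime (ρ : ℕ → ℝ≥0) : ℕ → ℝ≥0
  | 0 => 0
  | m + 1 => ρ m

theorem barrierTime_le {ρ : ℕ → ℝ≥0} (hρ : Monotone ρ) : ∀ m, barrierTime ρ m ≤ ρ m
  | 0 => zero_le
  | m + 1 => hρ m.le_succ

theorem monotone_barrierTime {ρ : ℕ → ℝ≥0} (hρ : Monotone ρ) : Monotone (barrierTime ρ) :=
  monotone_nat_of_le_succ (barrierTime_le hρ)

variable {ρ : ℕ → ℝ≥0}

theorem hybridSurvival_le_backwardProb (hμ : ∀ k i, StochasticallyLE (sojournLaw (M.A k) i) μ)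
    (hρ : Monotone ρ) {q m : ℕ} (hm : m + q = n) (x : M.State n) (hx : m ≤ M.level x) :
    M.hybridSurvival μ (fun k => ρ k) (barrierTime ρ m) x ≤
      backwardProb (M.generator n) (fun j => barrierTime ρ j) (fun j => {x | j ≤ M.level x})
        m q x := by
  have hr : Monotone fun k => (ρ k : ℝ) := fun _ _ h => hρ h
  induction q generalizing m x with
  | zero =>
    rcases x with _ | ⟨k, i⟩
    · exact le_rfl
    · exact absurd hx (hm ▸ k.2.not_ge)
  | succ q ih =>
    have hle : (barrierTime ρ m : ℝ) ≤ ρ m := barrierTime_le hρ m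
    refine (hybridSurvival_le_exp_mulVec hμ hr hle x (hr hx)).trans ?_
    refine (M.isMetzler_generator n).exp_smul_mulVec_mono_of_blockTriangular
      (M.blockTriangular_generator n) (sub_nonneg.2 hle) fun y hy => ?_
    rcases (hx.trans hy).lt_or_eq with hlt | rfl
    · rw [Set.indicator_of_mem (show y ∈ {x | m + 1 ≤ M.level x} from hlt)]
      exact ih (by omega) y hlt
    · rw [Set.indicator_of_notMem (by simp)]
      exact (hybridSurvival_eq_zero (r := fun k => (ρ k : ℝ)) y (by omega)).le

theorem backwardProb_le_hybridSurvival (hμ : ∀ k i, StochasticallyLE μ (sojournLaw (M.A k) i))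
    (hρ : Monotone ρ) {q m : ℕ} (hm : m + q = n) (x : M.State n) (hx : m ≤ M.level x) :
    backwardProb (M.generator n) (fun j => barrierTime ρ j) (fun j => {x | j ≤ M.level x})
        m q x ≤ M.hybridSurvival μ (fun k => ρ k) (barrierTime ρ m) x := by
  have hr : Monotone fun k => (ρ k : ℝ) := fun _ _ h => hρ h
  induction q generalizing m x with
  | zero =>
    rcases x with _ | ⟨k, i⟩
    · exact le_rfl
    · exact absurd hx (hm ▸ k.2.not_ge)
  | succ q ih =>
    have hle : (barrierTime ρ m : ℝ) ≤ ρ m := barrierTime_le hρ m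
    refine le_trans ?_ (exp_mulVec_le_hybridSurvival hμ hr hle x (hr hx))
    refine (M.isMetzler_generator n).exp_smul_mulVec_mono_of_blockTriangular
      (M.blockTriangular_generator n) (sub_nonneg.2 hle) fun y hy => ?_
    rcases (hx.trans hy).lt_or_eq with hlt | rfl
    · rw [Set.indicator_of_mem (show y ∈ {x | m + 1 ≤ M.level x} from hlt)]
      exact ih (by omega) y hlt
    · rw [Set.indicator_of_notMem (by simp)]
      exact (hybridSurvival_eq_zero (r := fun k => (ρ k : ℝ)) y (by omega)).ge

section BlockProcess

variable {Ω : Type*} [MeasurableSpace Ω] {P : Measure Ω} [IsProbabilityMeasure P]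
  {φ : ℝ≥0 → Ω → M.State n}

theorem measureReal_level_eq_sum (h : IsMarkovJumpProcess (M.generator n) (M.initial n) φ P)
    (hn : 0 < n) (hρ : Monotone ρ) :
    P.real {ω | ∀ m < n, m < M.level (φ (ρ m) ω)} =
      ∑ i, M.α i * backwardProb (M.generator n) (fun j => barrierTime ρ j)
        (fun j => {x | j ≤ M.level x}) 0 n (some ⟨⟨0, hn⟩, i⟩) := by
  rw [← sum_initial_mul, ← h.measureReal_forall_mem (monotone_barrierTime hρ) rfl]
  congr 1 with ω
  refine ⟨fun hω j hj hjn => ?_, fun hω m hm => hω (m + 1) m.succ_pos hm⟩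
  obtain ⟨m, rfl⟩ := Nat.exists_eq_add_one_of_ne_zero hj.ne'
  exact hω m hjn

theorem walkSurvival_le_measureReal_level
    (h : IsMarkovJumpProcess (M.generator n) (M.initial n) φ P)
    (hμ : ∀ k i, StochasticallyLE (sojournLaw (M.A k) i) μ) (hρ : Monotone ρ) :
    walkSurvival μ (fun k => ρ k) 0 n 0 ≤
      P.real {ω | ∀ m < n, m < M.level (φ (ρ m) ω)} := by
  rcases n.eq_zero_or_pos with rfl | hn
  · simp [walkSurvival]
  rw [measureReal_level_eq_sum h hn hρ, ← one_mul (walkSurvival _ _ _ _ _), ← M.α_sum,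
    Finset.sum_mul]
  gcongr with i
  · exact M.α_nonneg i
  · exact (walkSurvival_le_hybridSurvival hμ (some ⟨⟨0, hn⟩, i⟩) (ρ 0).2).trans
      (hybridSurvival_le_backwardProb hμ hρ (zero_add n) _ zero_le)

theorem measureReal_level_le_walkSurvival
    (h : IsMarkovJumpProcess (M.generator n) (M.initial n) φ P)
    (hμ : ∀ k i, StochasticallyLE μ (sojournLaw (M.A k) i)) (hρ : Monotone ρ) :
    P.real {ω | ∀ m < n, m < M.level (φ (ρ m) ω)} ≤
      walkSurvival μ (fun k => ρ k) 0 n 0 := by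
  rcases n.eq_zero_or_pos with rfl | hn
  · simp [walkSurvival]
  rw [measureReal_level_eq_sum h hn hρ, ← one_mul (walkSurvival _ _ _ _ _), ← M.α_sum,
    Finset.sum_mul]
  gcongr with i
  · exact M.α_nonneg i
  · exact (backwardProb_le_hybridSurvival hμ hρ (zero_add n) _ zero_le).trans
      (hybridSurvival_le_walkSurvival hμ (some ⟨⟨0, hn⟩, i⟩) (ρ 0).2)

end BlockProcess

end PhaseTypeRep

/-! ### Paths of the block process -/

theorem exists_mem_dense_of_eventually_nhdsGT {D : Set ℝ≥0} (hD : Dense D) {s : ℝ≥0}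
    {p : ℝ≥0 → Prop} (h : ∀ᶠ x in 𝓝[>] s, p x) : ∃ x ∈ D, p x := by
  obtain ⟨u, hu, hsub⟩ := mem_nhdsGT_iff_exists_Ioo_subset.1 h
  obtain ⟨x, hxD, hx⟩ := hD.exists_between hu
  exact ⟨x, hxD, hsub hx⟩

theorem monotone_of_monotoneOn_dense {α E : Type*} [Preorder α] {β : E → α} {f : ℝ≥0 → E}
    {D : Set ℝ≥0} (hD : Dense D) (hmono : MonotoneOn (fun t => β (f t)) D)
    (hf : ∀ t, ∀ᶠ s in 𝓝[≥] t, f s = f t) : Monotone fun t => β (f t) := by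
  refine monotone_iff_forall_lt.2 fun s t hst => ?_
  have hright (t : ℝ≥0) : ∀ᶠ s in 𝓝[>] t, f s = f t :=
    (hf t).filter_mono (nhdsWithin_mono _ Set.Ioi_subset_Ici_self)
  obtain ⟨s', hs'D, hs', hs't⟩ := exists_mem_dense_of_eventually_nhdsGT hD
    ((hright s).and (Ioo_mem_nhdsGT hst))
  obtain ⟨t', ht'D, ht', htt'⟩ := exists_mem_dense_of_eventually_nhdsGT hD
    ((hright t).and self_mem_nhdsWithin)
  rw [← hs', ← ht']
  exact hmono hs'D ht'D (hs't.2.trans htt').le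

namespace IsMarkovJumpProcess

variable {E Ω : Type*} [Fintype E] [DecidableEq E] [MeasurableSpace Ω] {P : Measure Ω}
  {Λ : Matrix E E ℝ} {π₀ : E → ℝ} {φ : ℝ≥0 → Ω → E}

theorem measurableSet_mem (h : IsMarkovJumpProcess Λ π₀ φ P) (t : ℝ≥0) (B : Set E) :
    MeasurableSet {ω | φ t ω ∈ B} := by
  rw [show {ω | φ t ω ∈ B} = ⋃ x ∈ B, {ω | φ t ω = x} by ext ω; simp]
  exact MeasurableSet.biUnion B.to_countable fun x _ => h.measurableSet_eq t x

theorem ae_monotone_of_blockTriangular [IsProbabilityMeasure P] {α : Type*} [LinearOrder α]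
    {β : E → α} (hβ : Λ.BlockTriangular β) (h : IsMarkovJumpProcess Λ π₀ φ P) :
    ∀ᵐ ω ∂P, Monotone fun t => β (φ t ω) := by
  obtain ⟨D, hDc, hD⟩ := TopologicalSpace.exists_countable_dense ℝ≥0
  have hD_le : ∀ᵐ ω ∂P, ∀ s ∈ D, ∀ t ∈ D, s ≤ t → ∀ x y, β y < β x →
      ¬(φ s ω = x ∧ φ t ω = y) := by
    simp only [ae_ball_iff hDc, ae_all_iff]
    intro s _ t _ hst x y hlt
    exact measure_eq_zero_iff_ae_notMem.1
      (h.measure_eq_and_eq_of_exp_eq_zero hst (exp_smul_apply_eq_zero_of_lt hβ _ hlt))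
  filter_upwards [hD_le, h.right_continuous] with ω hω hrc
  exact monotone_of_monotoneOn_dense hD
    (fun s hs t ht hst => not_lt.1 fun hlt => hω s hs t ht hst _ _ hlt ⟨rfl, rfl⟩) hrc

end IsMarkovJumpProcess

namespace PhaseTypeRep

variable {M : PhaseTypeRep} {n : ℕ}

section Path

/-- The times which the path `φ` spends in the blocks `0, …, m`. -/
def timesUpTo (φ : ℝ≥0 → M.State n) (m : ℕ) : Set ℝ :=
  {s | 0 ≤ s ∧ M.level (φ s.toNNReal) ≤ m}

variable {φ : ℝ≥0 → M.State n}

theorem exists_eq_some_iff_level_eq {x : M.State n} {k : Fin n} :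
    (∃ i, x = some ⟨k, i⟩) ↔ M.level x = k := by
  refine ⟨fun ⟨i, hi⟩ => hi ▸ rfl, fun h => ?_⟩
  rcases x with _ | ⟨l, i⟩
  · exact absurd h k.2.ne'
  · obtain rfl : l = k := Fin.ext h
    exact ⟨i, rfl⟩

theorem timeIn_eq_volume_level (k : Fin n) :
    M.timeIn φ k = volume {s : ℝ | 0 ≤ s ∧ M.level (φ s.toNNReal) = k} := by
  simp only [timeIn, exists_eq_some_iff_level_eq]

theorem measurableSet_level_eq (hmono : Monotone fun t => M.level (φ t)) (k : ℕ) :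
    MeasurableSet {s : ℝ | 0 ≤ s ∧ M.level (φ s.toNNReal) = k} :=
  Set.OrdConnected.measurableSet ⟨fun _ hx _ hy _ hz => ⟨hx.1.trans hz.1, le_antisymm
    ((hmono (Real.toNNReal_le_toNNReal hz.2)).trans_eq hy.2)
    (hx.2.symm.trans_le (hmono (Real.toNNReal_le_toNNReal hz.1)))⟩⟩

theorem sum_timeIn_eq_volume (hmono : Monotone fun t => M.level (φ t)) (j : Fin n) :
    ∑ k ∈ Finset.Iic j, M.timeIn φ k = volume (timesUpTo φ j) := by
  have hunion : timesUpTo φ j =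
      ⋃ k ∈ Finset.Iic j, {s : ℝ | 0 ≤ s ∧ M.level (φ s.toNNReal) = k} := by
    ext s
    simp only [timesUpTo, Set.mem_ofPred_eq, Set.mem_iUnion, Finset.mem_Iic, exists_prop]
    exact ⟨fun ⟨h0, h⟩ => ⟨⟨_, h.trans_lt j.2⟩, h, h0, rfl⟩, fun ⟨k, hk, h0, h⟩ =>
      ⟨h0, h.trans_le hk⟩⟩
  simp only [hunion, timeIn_eq_volume_level]
  exact (measure_biUnion_finset (fun k _ l _ hkl => Set.disjoint_left.2 fun s hs hs' =>
    hkl (Fin.ext (hs.2.symm.trans hs'.2))) fun k _ => measurableSet_level_eq hmono k).symm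

theorem timesUpTo_subset_Icc (hmono : Monotone fun t => M.level (φ t)) {m : ℕ} {t : ℝ≥0}
    (ht : m < M.level (φ t)) : timesUpTo φ m ⊆ Set.Icc 0 (t : ℝ) := fun _ hs =>
  ⟨hs.1, le_of_not_gt fun hts =>
    (ht.trans_le (hmono (NNReal.le_toNNReal_of_coe_le hts.le))).not_ge hs.2⟩

theorem exists_Ico_subset_timesUpTo (hmono : Monotone fun t => M.level (φ t)) {m : ℕ} {t : ℝ≥0}
    (hrc : ∀ᶠ s in 𝓝[≥] t, φ s = φ t) (ht : M.level (φ t) ≤ m) :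
    ∃ u > t, Set.Ico 0 (u : ℝ) ⊆ timesUpTo φ m := by
  obtain ⟨u, hu, hsub⟩ := mem_nhdsGE_iff_exists_Ico_subset.1 hrc
  refine ⟨u, hu, fun s hs => ⟨hs.1, ?_⟩⟩
  rcases le_total s.toNNReal t with hst | hst
  · exact (hmono hst).trans ht
  · have hφ : φ s.toNNReal = φ t := hsub ⟨hst, (Real.toNNReal_lt_iff_lt_coe hs.1).2 hs.2⟩
    exact hφ ▸ ht

theorem volume_timesUpTo_toReal_le_iff (hmono : Monotone fun t => M.level (φ t)) {m : ℕ}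
    {t : ℝ≥0} (hrc : ∀ᶠ s in 𝓝[≥] t, φ s = φ t) (hfin : volume (timesUpTo φ m) ≠ ∞) :
    (volume (timesUpTo φ m)).toReal ≤ t ↔ m < M.level (φ t) := by
  constructor
  · refine fun hle => lt_of_not_ge fun ht => ?_
    obtain ⟨u, htu, hsub⟩ := exists_Ico_subset_timesUpTo hmono hrc ht
    have hu := ENNReal.toReal_mono hfin (measure_mono hsub)
    rw [Real.volume_Ico, sub_zero, ENNReal.toReal_ofReal u.coe_nonneg] at hu
    exact (hu.trans hle).not_gt htu
  · intro ht
    have h := ENNReal.toReal_mono measure_Icc_lt_top.ne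
      (measure_mono (μ := volume) (timesUpTo_subset_Icc hmono ht))
    rwa [Real.volume_Icc, sub_zero, ENNReal.toReal_ofReal t.coe_nonneg] at h

theorem timeIn_mem_barrierSet_iff (hmono : Monotone fun t => M.level (φ t))
    (hrc : ∀ t : ℝ≥0, ∀ᶠ s in 𝓝[≥] t, φ s = φ t) {T : ℝ≥0} (hT : ∀ m < n, m < M.level (φ T))
    (ρ : ℕ → ℝ≥0) :
    (fun k => (M.timeIn φ k).toReal) ∈ barrierSet (fun m => ρ m) n ↔
      ∀ m < n, m < M.level (φ (ρ m)) := by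
  simp only [barrierSet, Set.mem_ofPred_eq,
    ← Fin.forall_iff (p := fun j => j.1 < M.level (φ (ρ j)))]
  refine forall_congr' fun j => ?_
  have hsum := sum_timeIn_eq_volume hmono j
  have hfin : volume (timesUpTo φ j) ≠ ∞ :=
    ((measure_mono (timesUpTo_subset_Icc hmono (hT j j.2))).trans_lt measure_Icc_lt_top).ne
  rw [← ENNReal.toReal_sum (ENNReal.sum_ne_top.1 (hsum ▸ hfin)), hsum,
    volume_timesUpTo_toReal_le_iff hmono (hrc _) hfin]

end Path

variable {Ω : Type*} [MeasurableSpace Ω] {P : Measure Ω} [IsProbabilityMeasure P]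
  {φ : ℝ≥0 → Ω → M.State n} {μ : Measure ℝ} [IsProbabilityMeasure μ] [NullSingletonClass μ]

theorem ae_exists_forall_lt_level (h : IsMarkovJumpProcess (M.generator n) (M.initial n) φ P)
    (hμ : ∀ k i, StochasticallyLE (sojournLaw (M.A k) i) μ) :
    ∀ᵐ ω ∂P, ∃ T : ℝ≥0, ∀ m < n, m < M.level (φ T ω) := by
  have hmeas : MeasurableSet (⋃ N : ℕ, {ω | ∀ m < n, m < M.level (φ (N : ℝ≥0) ω)}) :=
    .iUnion fun N => h.measurableSet_mem N {x | ∀ m < n, m < M.level x}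
  have hone : 1 ≤ P.real (⋃ N : ℕ, {ω | ∀ m < n, m < M.level (φ (N : ℝ≥0) ω)}) :=
    le_of_tendsto' ((tendsto_walkSurvival_const μ 0 n 0).comp tendsto_natCast_atTop_atTop) fun N =>
      (walkSurvival_le_measureReal_level (ρ := fun _ => N) h hμ monotone_const).trans
        (measureReal_mono (Set.subset_iUnion
          (fun N : ℕ => {ω | ∀ m < n, m < M.level (φ (N : ℝ≥0) ω)}) N))
  have hall : P (⋃ N : ℕ, {ω | ∀ m < n, m < M.level (φ (N : ℝ≥0) ω)}) = 1 :=
    (ENNReal.toReal_eq_one_iff _).1 (measureReal_le_one.antisymm hone)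
  filter_upwards [(mem_ae_iff_prob_eq_one hmeas).2 hall] with ω hω
  obtain ⟨N, hN⟩ := Set.mem_iUnion.1 hω
  exact ⟨N, hN⟩

theorem measure_timeIn_mem_barrierSet
    (h : IsMarkovJumpProcess (M.generator n) (M.initial n) φ P)
    (hμ : ∀ k i, StochasticallyLE (sojournLaw (M.A k) i) μ) (ρ : ℕ → ℝ≥0) :
    P {ω | (fun k => (M.timeIn (fun s => φ s ω) k).toReal) ∈ barrierSet (fun m => ρ m) n} =
      P {ω | ∀ m < n, m < M.level (φ (ρ m) ω)} := by
  refine measure_congr ?_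
  filter_upwards [h.ae_monotone_of_blockTriangular (M.blockTriangular_generator n),
    h.right_continuous, ae_exists_forall_lt_level h hμ] with ω hmono hrc ⟨T, hT⟩
  exact propext (timeIn_mem_barrierSet_iff hmono hrc hT ρ)

end PhaseTypeRep

/-! ### Ruin by independent claims -/

theorem mem_ultimateRuin_reserve {Ω : Type*} {u c : ℝ} {N : ℝ≥0 → Ω → ℕ} {X : ℕ → Ω → ℝ} {ω : Ω} :
    ω ∈ ultimateRuin (reserve u c N X) ↔
      ∃ t : ℝ≥0, u + c * t < ∑ k ∈ Finset.range (N t ω), X k ω := by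
  simp only [ultimateRuin, reserve, Set.mem_ofPred_eq, iInf_lt_iff, EReal.coe_neg', sub_neg]

theorem mem_ultimateRuin_reserve_iff_mem_dense {Ω : Type*} {u c : ℝ} {N : ℝ≥0 → Ω → ℕ}
    {X : ℕ → Ω → ℝ} {ω : Ω} {D : Set ℝ≥0} (hD : Dense D)
    (hω : ∀ t : ℝ≥0, ∀ᶠ s in 𝓝[≥] t, N s ω = N t ω) :
    ω ∈ ultimateRuin (reserve u c N X) ↔
      ∃ t : D, u + c * (t : ℝ≥0) < ∑ k ∈ Finset.range (N t ω), X k ω := by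
  rw [mem_ultimateRuin_reserve]
  refine ⟨fun ⟨t, ht⟩ => ?_, fun ⟨t, ht⟩ => ⟨t, ht⟩⟩
  have hcapital : ContinuousWithinAt (fun s : ℝ≥0 => u + c * (s : ℝ)) (Set.Ioi t) t := by
    fun_prop
  obtain ⟨s, hsD, hs, hNs⟩ := exists_mem_dense_of_eventually_nhdsGT hD
    ((hcapital.eventually_lt_const ht).and
      ((hω t).filter_mono (nhdsWithin_mono _ Set.Ioi_subset_Ici_self)))
  exact ⟨⟨s, hsD⟩, hNs.symm ▸ hs⟩

/-- Given the numbers `κ i` of claims which have occurred at finitely many times, and the capital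
`b i` received by then, the capital against which the sum of the claims `0, …, m` is first
compared: the smallest `b i` with `m < κ i`. The largest `b i` is used where there is none, so that
the barriers increase with `m`. -/
noncomputable def claimBarrier {ι : Type*} [Fintype ι] (b : ι → ℝ≥0) (κ : ι → ℕ) (m : ℕ) : ℝ≥0 :=
  (Finset.univ.filter fun i => m < κ i).fold min (Finset.univ.sup b) b

section ClaimBarrier

variable {ι : Type*} [Fintype ι] {b : ι → ℝ≥0} {κ : ι → ℕ}

theorem le_claimBarrier_iff {m : ℕ} {a : ℝ≥0} :
    a ≤ claimBarrier b κ m ↔ a ≤ Finset.univ.sup b ∧ ∀ i, m < κ i → a ≤ b i := by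
  simp [claimBarrier, Finset.le_fold_min]

theorem monotone_claimBarrier (b : ι → ℝ≥0) (κ : ι → ℕ) : Monotone (claimBarrier b κ) :=
  fun m _ hm => le_claimBarrier_iff.2
    ⟨(le_claimBarrier_iff (m := m).1 le_rfl).1, fun i hi =>
      (le_claimBarrier_iff.1 le_rfl).2 i (hm.trans_lt hi)⟩

theorem forall_sum_le_iff_mem_barrierSet {x : ℕ → ℝ} (hx : ∀ k, 0 ≤ x k) :
    (∀ i, ∑ k ∈ Finset.range (κ i), x k ≤ b i) ↔
      (fun k : Fin (Finset.univ.sup κ) => x k) ∈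
        barrierSet (fun m => claimBarrier b κ m) (Finset.univ.sup κ) := by
  lift x to ℕ → ℝ≥0 using hx
  rw [mem_barrierSet_nat (x := fun k => (x k : ℝ))]
  beta_reduce
  norm_cast
  constructor
  · intro h m hm
    have hsum : ∀ i, m < κ i → ∑ k ∈ Finset.range (m + 1), x k ≤ b i := fun i hi =>
      (Finset.sum_le_sum_of_subset (Finset.range_mono hi)).trans (h i)
    obtain ⟨i, -, hi⟩ := Finset.lt_sup_iff.1 hm
    exact le_claimBarrier_iff.2 ⟨(hsum i hi).trans (Finset.le_sup (Finset.mem_univ i)), hsum⟩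
  · intro h i
    rcases hκ : κ i with _ | m
    · simp
    · have hm : m < κ i := hκ ▸ m.lt_succ_self
      exact (le_claimBarrier_iff.1
        (h m (hm.trans_le (Finset.le_sup (Finset.mem_univ i))))).2 i hm

end ClaimBarrier

section Claims

variable {Ω : Type*} [MeasurableSpace Ω]

/-- `X` is a sequence of nonnegative claims which is independent of the arrival process `N`. -/
structure IsIndepClaims (N : ℝ≥0 → Ω → ℕ) (X : ℕ → Ω → ℝ) (P : Measure Ω) : Prop where
  aemeasurable : ∀ k, AEMeasurable (X k) P
  ae_nonneg : ∀ k, ∀ᵐ ω ∂P, 0 ≤ X k ω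
  indepFun : ∀ n : ℕ, IndepFun (fun ω (k : Fin n) => X k ω) (fun ω (t : ℝ≥0) => N t ω) P

/-- The claims `X` are less dangerous than the claims `X'`: their partial sums are at least as
likely to stay below any given increasing barriers. -/
def BarrierLE (X X' : ℕ → Ω → ℝ) (P : Measure Ω) : Prop :=
  ∀ (n : ℕ) (ρ : ℕ → ℝ≥0), Monotone ρ →
    P {ω | (fun k : Fin n => X' k ω) ∈ barrierSet (fun m => ρ m) n} ≤
      P {ω | (fun k : Fin n => X k ω) ∈ barrierSet (fun m => ρ m) n}

variable {N : ℝ≥0 → Ω → ℕ} {X X' : ℕ → Ω → ℝ} {P : Measure Ω}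

namespace IsIndepClaims

theorem indepFun_sum_range {ι : Type*} [Finite ι] (h : IsIndepClaims N X P) (q : ι → ℝ≥0)
    (κ : ι → ℕ) :
    IndepFun (fun ω i => ∑ k ∈ Finset.range (κ i), X k ω) (fun ω i => N (q i) ω) P := by
  obtain ⟨n, hn⟩ := (Set.finite_range κ).bddAbove
  have hκ (i : ι) : κ i ≤ n := hn ⟨i, rfl⟩
  simp only [Finset.sum_range]
  exact (h.indepFun n).comp
    (φ := fun y i => ∑ k : Fin (κ i), y (k.castLE (hκ i))) (ψ := fun f i => f (q i))
    (by fun_prop) (by fun_prop)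

theorem nullMeasurableSet_forall_sum_le {ι : Type*} [Countable ι] (h : IsIndepClaims N X P)
    (b : ι → ℝ≥0) (κ : ι → ℕ) :
    NullMeasurableSet {ω | ∀ i, ∑ k ∈ Finset.range (κ i), X k ω ≤ b i} P := by
  simp only [Set.ofPred_forall]
  exact .iInter fun i => nullMeasurableSet_le
    (Finset.aemeasurable_fun_sum _ fun k _ => h.aemeasurable k) aemeasurable_const

theorem measure_forall_sum_le {ι : Type*} [Fintype ι] (h : IsIndepClaims N X P) (b : ι → ℝ≥0)
    (κ : ι → ℕ) :
    P {ω | ∀ i, ∑ k ∈ Finset.range (κ i), X k ω ≤ b i} =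
      P {ω | (fun k : Fin (Finset.univ.sup κ) => X k ω) ∈
        barrierSet (fun m => claimBarrier b κ m) (Finset.univ.sup κ)} := by
  refine measure_congr ?_
  filter_upwards [ae_all_iff.2 h.ae_nonneg] with ω hω
  exact propext (forall_sum_le_iff_mem_barrierSet hω)

theorem measure_exists_lt_sum_le [IsProbabilityMeasure P] {ι : Type*} [Finite ι]
    (h : IsIndepClaims N X P) (h' : IsIndepClaims N X' P) (hle : BarrierLE X X' P)
    (b : ι → ℝ≥0) (κ : ι → ℕ) :
    P {ω | ∃ i, (b i : ℝ) < ∑ k ∈ Finset.range (κ i), X k ω} ≤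
      P {ω | ∃ i, (b i : ℝ) < ∑ k ∈ Finset.range (κ i), X' k ω} := by
  cases nonempty_fintype ι
  have hcompl (Z : ℕ → Ω → ℝ) : {ω | ∃ i, (b i : ℝ) < ∑ k ∈ Finset.range (κ i), Z k ω} =
      {ω | ∀ i, ∑ k ∈ Finset.range (κ i), Z k ω ≤ b i}ᶜ := by
    ext ω
    simp
  rw [hcompl, hcompl, prob_compl_eq_one_sub₀ (h.nullMeasurableSet_forall_sum_le b κ),
    prob_compl_eq_one_sub₀ (h'.nullMeasurableSet_forall_sum_le b κ), h.measure_forall_sum_le,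
    h'.measure_forall_sum_le]
  exact tsub_le_tsub_left (hle _ _ (monotone_claimBarrier b κ)) _

theorem measure_exists_lt_sum_eq_tsum {ι : Type*} [Finite ι] (h : IsIndepClaims N X P)
    (hN : ∀ t, Measurable (N t)) (q b : ι → ℝ≥0) :
    P {ω | ∃ i, (b i : ℝ) < ∑ k ∈ Finset.range (N (q i) ω), X k ω} =
      ∑' κ : ι → ℕ, P {ω | ∃ i, (b i : ℝ) < ∑ k ∈ Finset.range (κ i), X k ω} *
        P ((fun ω i => N (q i) ω) ⁻¹' {κ}) := by
  have hcounts : Measurable fun ω i => N (q i) ω := measurable_pi_lambda _ fun i => hN (q i)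
  have hpart := tsum_measure_preimage_singleton
    (μ := P.restrict {ω | ∃ i, (b i : ℝ) < ∑ k ∈ Finset.range (N (q i) ω), X k ω})
    Set.countable_univ fun κ _ => hcounts (measurableSet_singleton κ)
  rw [Set.preimage_univ, Measure.restrict_apply_univ, tsum_univ
    (fun κ => P.restrict _ ((fun ω i => N (q i) ω) ⁻¹' {κ}))] at hpart
  refine hpart.symm.trans (tsum_congr fun κ => ?_)
  have hmeas : MeasurableSet {s : ι → ℝ | ∃ i, (b i : ℝ) < s i} := by
    simp only [Set.ofPred_exists]
    exact .iUnion fun i => measurableSet_lt measurable_const (measurable_pi_apply i)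
  rw [Measure.restrict_apply (hcounts (measurableSet_singleton κ)), Set.inter_comm]
  refine Eq.trans (congrArg P ?_) ((h.indepFun_sum_range q κ).measure_inter_preimage_eq_mul _ _
    hmeas (measurableSet_singleton κ))
  ext ω
  refine and_congr_left fun hω => exists_congr fun i => ?_
  rw [show N (q i) ω = κ i from congrFun hω i]

theorem measure_exists_lt_sum_le_of_countable [IsProbabilityMeasure P] {ι : Type*} [Countable ι]
    (h : IsIndepClaims N X P) (h' : IsIndepClaims N X' P) (hle : BarrierLE X X' P)
    (hN : ∀ t, Measurable (N t)) (q b : ι → ℝ≥0) :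
    P {ω | ∃ i, (b i : ℝ) < ∑ k ∈ Finset.range (N (q i) ω), X k ω} ≤
      P {ω | ∃ i, (b i : ℝ) < ∑ k ∈ Finset.range (N (q i) ω), X' k ω} := by
  have hsup (Z : ℕ → Ω → ℝ) :
      P {ω | ∃ i, (b i : ℝ) < ∑ k ∈ Finset.range (N (q i) ω), Z k ω} =
        ⨆ F : Finset ι, P {ω | ∃ i : F, (b i : ℝ) < ∑ k ∈ Finset.range (N (q i) ω), Z k ω} := by
    have hmono : Monotone fun F : Finset ι =>
        {ω | ∃ i : F, (b i : ℝ) < ∑ k ∈ Finset.range (N (q i) ω), Z k ω} :=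
      fun F G hFG ω ⟨i, hi⟩ => ⟨⟨i, hFG i.2⟩, hi⟩
    rw [← hmono.directed_le.measure_iUnion]
    congr 1
    ext ω
    simp only [Set.mem_ofPred_eq, Set.mem_iUnion]
    exact ⟨fun ⟨i, hi⟩ => ⟨{i}, ⟨i, Finset.mem_singleton_self i⟩, hi⟩,
      fun ⟨_, i, hi⟩ => ⟨i, hi⟩⟩
  rw [hsup, hsup]
  refine iSup_mono fun F => ?_
  rw [h.measure_exists_lt_sum_eq_tsum hN (fun i : F => q i) (fun i => b i),
    h'.measure_exists_lt_sum_eq_tsum hN (fun i : F => q i) (fun i => b i)]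
  exact ENNReal.tsum_le_tsum fun κ =>
    mul_le_mul_left (measure_exists_lt_sum_le h h' hle (fun i : F => b i) κ) _

end IsIndepClaims

theorem BarrierLE.measure_ultimateRuin_le [IsProbabilityMeasure P] (hle : BarrierLE X X' P)
    (h : IsIndepClaims N X P) (h' : IsIndepClaims N X' P) (hN : ∀ t, Measurable (N t))
    (hNrc : ∀ᵐ ω ∂P, ∀ t : ℝ≥0, ∀ᶠ s in 𝓝[≥] t, N s ω = N t ω) {u c : ℝ} (hu : 0 ≤ u)
    (hc : 0 ≤ c) :
    P (ultimateRuin (reserve u c N X)) ≤ P (ultimateRuin (reserve u c N X')) := by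
  lift u to ℝ≥0 using hu
  lift c to ℝ≥0 using hc
  obtain ⟨D, hDc, hD⟩ := TopologicalSpace.exists_countable_dense ℝ≥0
  have : Countable D := hDc
  have hruin (Z : ℕ → Ω → ℝ) : P (ultimateRuin (reserve u c N Z)) =
      P {ω | ∃ t : D, ((u + c * t : ℝ≥0) : ℝ) < ∑ k ∈ Finset.range (N t ω), Z k ω} := by
    refine measure_congr ?_
    filter_upwards [hNrc] with ω hω
    exact propext (mod_cast mem_ultimateRuin_reserve_iff_mem_dense hD hω)
  rw [hruin, hruin]
  exact h.measure_exists_lt_sum_le_of_countable h' hle hN (fun t : D => t) fun t => u + c * t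

end Claims

/-! ### Comparison of phase-type claims with i.i.d. claims -/

namespace IsMultivariatePhaseType

variable {Ω : Type*} [MeasurableSpace Ω] {P : Measure Ω} {M : PhaseTypeRep} {n : ℕ}
  {Y : Ω → Fin n → ℝ} {μ : Measure ℝ} [IsProbabilityMeasure μ] [NullSingletonClass μ] {ρ : ℕ → ℝ≥0}

theorem ae_nonneg (hY : IsMultivariatePhaseType M n Y P) (k : Fin n) : ∀ᵐ ω ∂P, 0 ≤ Y ω k := by
  obtain ⟨Ω', _, P', _, φ, -, hid⟩ := hY
  exact hid.symm.ae_snd (p := fun y => 0 ≤ y k)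
    (measurableSet_le measurable_const (measurable_pi_apply k))
    (ae_of_all _ fun _ => ENNReal.toReal_nonneg)

theorem aemeasurable (hY : IsMultivariatePhaseType M n Y P) (k : Fin n) :
    AEMeasurable (fun ω => Y ω k) P := by
  obtain ⟨Ω', _, P', _, φ, -, hid⟩ := hY
  exact (measurable_pi_apply k).comp_aemeasurable hid.aemeasurable_fst

theorem walkSurvival_le_measure_barrierSet (hY : IsMultivariatePhaseType M n Y P)
    (hμ : ∀ k i, StochasticallyLE (sojournLaw (M.A k) i) μ) (hρ : Monotone ρ) :
    ENNReal.ofReal (walkSurvival μ (fun m => ρ m) 0 n 0) ≤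
      P {ω | Y ω ∈ barrierSet (fun m => ρ m) n} := by
  obtain ⟨Ω', _, P', _, φ, h, hid⟩ := hY
  refine le_of_le_of_eq ?_ (hid.measure_mem_eq (measurableSet_barrierSet _ n)).symm
  refine le_of_le_of_eq ?_ (PhaseTypeRep.measure_timeIn_mem_barrierSet h hμ ρ).symm
  rw [← ofReal_measureReal]
  exact ENNReal.ofReal_le_ofReal (PhaseTypeRep.walkSurvival_le_measureReal_level h hμ hρ)

theorem measure_barrierSet_le_walkSurvival (hY : IsMultivariatePhaseType M n Y P)
    {κ : Measure ℝ} [IsProbabilityMeasure κ] [NullSingletonClass κ]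
    (hκ : ∀ k i, StochasticallyLE κ (sojournLaw (M.A k) i))
    (hμ : ∀ k i, StochasticallyLE (sojournLaw (M.A k) i) μ) (hρ : Monotone ρ) :
    P {ω | Y ω ∈ barrierSet (fun m => ρ m) n} ≤
      ENNReal.ofReal (walkSurvival κ (fun m => ρ m) 0 n 0) := by
  obtain ⟨Ω', _, P', _, φ, h, hid⟩ := hY
  refine (hid.measure_mem_eq (measurableSet_barrierSet _ n)).trans_le ?_
  refine (PhaseTypeRep.measure_timeIn_mem_barrierSet h hμ ρ).trans_le ?_
  rw [← ofReal_measureReal]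
  exact ENNReal.ofReal_le_ofReal (PhaseTypeRep.measureReal_level_le_walkSurvival h hκ hρ)

end IsMultivariatePhaseType

section Comparison

variable {Ω : Type*} [MeasurableSpace Ω] {P : Measure Ω} {N : ℝ≥0 → Ω → ℕ} {M : PhaseTypeRep}
  {X Y : ℕ → Ω → ℝ} {μ : Measure ℝ}

theorem isIndepClaims_of_hasLaw (hμ : μ (Set.Iio 0) = 0) (hlaw : ∀ k, HasLaw (X k) μ P)
    (hXN : IndepFun (fun ω k => X k ω) (fun ω (t : ℝ≥0) => N t ω) P) : IsIndepClaims N X P where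
  aemeasurable k := (hlaw k).aemeasurable
  ae_nonneg k := by
    rw [(hlaw k).ae_iff (p := fun x => 0 ≤ x) (measurableSet_setOfPred.1 measurableSet_Ici),
      ae_iff]
    simp only [not_le]
    exact hμ
  indepFun n := hXN.comp (φ := fun (x : ℕ → ℝ) (k : Fin n) => x k) (ψ := id)
    (by fun_prop) measurable_id

theorem isIndepClaims_of_isMultivariatePhaseType
    (hY : ∀ n : ℕ, 1 ≤ n → IsMultivariatePhaseType M n (fun ω k => Y k ω) P)
    (hYN : ∀ n : ℕ, 1 ≤ n →
      IndepFun (fun ω (k : Fin n) => Y k ω) (fun ω (t : ℝ≥0) => N t ω) P) :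
    IsIndepClaims N Y P where
  aemeasurable k := (hY (k + 1) k.succ_pos).aemeasurable (Fin.last k)
  ae_nonneg k := (hY (k + 1) k.succ_pos).ae_nonneg (Fin.last k)
  indepFun n := (hYN (n + 1) n.succ_pos).comp
    (φ := fun (y : Fin (n + 1) → ℝ) (k : Fin n) => y k.castSucc) (ψ := id)
    (by fun_prop) measurable_id

variable [IsProbabilityMeasure P] [NullSingletonClass μ]

theorem barrierLE_of_sojournLaw_stochasticallyLE
    (hY : ∀ n : ℕ, 1 ≤ n → IsMultivariatePhaseType M n (fun ω k => Y k ω) P)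
    (hμ : ∀ k i, StochasticallyLE (sojournLaw (M.A k) i) μ) (hlaw : ∀ k, HasLaw (X k) μ P)
    (hX : iIndepFun X P) : BarrierLE Y X P := by
  intro n ρ hρ
  have : IsProbabilityMeasure μ := (hlaw 0).isProbabilityMeasure_iff.1 ‹_›
  rcases n.eq_zero_or_pos with rfl | hn
  · simp [barrierSet]
  rw [measure_barrierSet_eq_walkSurvival hlaw hX]
  exact (hY n hn).walkSurvival_le_measure_barrierSet hμ hρ

theorem barrierLE_of_stochasticallyLE_sojournLaw
    (hY : ∀ n : ℕ, 1 ≤ n → IsMultivariatePhaseType M n (fun ω k => Y k ω) P)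
    {κ : Measure ℝ} [NullSingletonClass κ] [IsProbabilityMeasure μ]
    (hκ : ∀ k i, StochasticallyLE κ (sojournLaw (M.A k) i))
    (hμ : ∀ k i, StochasticallyLE (sojournLaw (M.A k) i) μ) (hlaw : ∀ k, HasLaw (X k) κ P)
    (hX : iIndepFun X P) : BarrierLE X Y P := by
  intro n ρ hρ
  have : IsProbabilityMeasure κ := (hlaw 0).isProbabilityMeasure_iff.1 ‹_›
  rcases n.eq_zero_or_pos with rfl | hn
  · simp [barrierSet]
  rw [measure_barrierSet_eq_walkSurvival hlaw hX]
  exact (hY n hn).measure_barrierSet_le_walkSurvival hκ hμ hρ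

end Comparison

namespace PhaseTypeRep

variable (M : PhaseTypeRep)

theorem dim_zero_pos : 0 < M.dim 0 := by
  by_contra! h
  have : IsEmpty (Fin (M.dim 0)) := by rw [Nat.le_zero.1 h]; infer_instance
  exact zero_ne_one ((Finset.sum_of_isEmpty _).symm.trans M.α_sum)

theorem exitRate_bound_pos {ν : ℝ} (hν : ∀ k i, -(M.A k *ᵥ 1) i ≤ ν) : 0 < ν := by
  by_contra! hν0
  have htransient : Tendsto
      (fun t : ℝ => (NormedSpace.exp (t • M.A 0) *ᵥ 1) ⟨0, M.dim_zero_pos⟩) atTop (𝓝 0) := by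
    simpa [Matrix.mulVec, dotProduct] using
      tendsto_finsetSum Finset.univ fun j _ => M.transient 0 ⟨0, M.dim_zero_pos⟩ j
  refine zero_lt_one.not_ge (ge_of_tendsto htransient ?_)
  filter_upwards [eventually_ge_atTop (0 : ℝ)] with t ht
  calc (1 : ℝ) ≤ Real.exp (-(ν * t)) :=
        Real.one_le_exp (neg_nonneg.2 (mul_nonpos_of_nonpos_of_nonneg hν0 ht))
    _ ≤ _ := (M.isMetzler_A 0).exp_neg_mul_le_exp_smul_mulVec_one (hν 0) ht _

end PhaseTypeRep

instance nullSingletonClass_expMeasure (ν : ℝ) : NullSingletonClass (expMeasure ν) :=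
  nullSingletonClass_gammaMeasure 1 ν

theorem mainTheorem8_general {Ω : Type*} [MeasurableSpace Ω] {P : Measure Ω}
    [IsProbabilityMeasure P] {u c : ℝ} (hu : 0 ≤ u) (hc : 0 ≤ c) {N : ℝ≥0 → Ω → ℕ}
    (hN : ∀ t, Measurable (N t))
    (hNrc : ∀ᵐ ω ∂P, ∀ t : ℝ≥0, ∀ᶠ s in 𝓝[≥] t, N s ω = N t ω)
    {M : PhaseTypeRep} {Y : ℕ → Ω → ℝ}
    (hY : ∀ n : ℕ, 1 ≤ n → IsMultivariatePhaseType M n (fun ω k => Y k ω) P)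
    (hYN : ∀ n : ℕ, 1 ≤ n →
      IndepFun (fun ω (k : Fin n) => Y k ω) (fun ω (t : ℝ≥0) => N t ω) P)
    {p : ℕ} (hp : ∀ k, M.dim k ≤ p) {ν : ℝ} (hν : ∀ k i, -(∑ j, M.A k i j) ≤ ν)
    {σ : ℝ} (hσ : 0 < σ) (hA : ∀ k z, IsDominantEigenvalue (M.A k) z → z.re ≤ -σ)
    {L : ℕ → Ω → ℝ} (hLlaw : ∀ k, HasLaw (L k) (expMeasure ν) P) (hL : iIndepFun L P)
    (hLN : IndepFun (fun ω k => L k ω) (fun ω (t : ℝ≥0) => N t ω) P)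
    {H : ℕ → Ω → ℝ} (hHlaw : ∀ k, HasLaw (H k) (gammaMeasure p σ) P) (hH : iIndepFun H P)
    (hHN : IndepFun (fun ω k => H k ω) (fun ω (t : ℝ≥0) => N t ω) P) :
    P (ultimateRuin (reserve u c N L)) ≤ P (ultimateRuin (reserve u c N Y)) ∧
      P (ultimateRuin (reserve u c N Y)) ≤ P (ultimateRuin (reserve u c N H)) := by
  have hexit : ∀ k i, -(M.A k *ᵥ 1) i ≤ ν := by simpa [Matrix.mulVec, dotProduct] using hν
  have hprob : IsProbabilityMeasure (gammaMeasure p σ) :=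
    (hHlaw 0).isProbabilityMeasure_iff.1 ‹_›
  have hlower : ∀ k i, StochasticallyLE (expMeasure ν) (sojournLaw (M.A k) i) := fun k =>
    (M.isMetzler_A k).exponential_stochasticallyLE_sojournLaw (M.A_mulVec_one_nonpos k)
      (M.exitRate_bound_pos hexit) (hexit k)
  have hupper : ∀ k i, StochasticallyLE (sojournLaw (M.A k) i) (gammaMeasure p σ) := fun k =>
    (M.isMetzler_A k).sojournLaw_stochasticallyLE_erlang (M.A_mulVec_one_nonpos k) hσ (hA k) (hp k)
  have hYclaims := isIndepClaims_of_isMultivariatePhaseType hY hYN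
  have hLclaims := isIndepClaims_of_hasLaw (gammaMeasure_Iio_zero 1 ν) hLlaw hLN
  have hHclaims := isIndepClaims_of_hasLaw (gammaMeasure_Iio_zero p σ) hHlaw hHN
  have hLY := barrierLE_of_stochasticallyLE_sojournLaw hY hlower hupper hLlaw hL
  have hYH := barrierLE_of_sojournLaw_stochasticallyLE hY hupper hHlaw hH
  exact ⟨hLY.measure_ultimateRuin_le hLclaims hYclaims hN hNrc hu hc,
    hYH.measure_ultimateRuin_le hYclaims hHclaims hN hNrc hu hc⟩

theorem mainTheorem8 {Ω : Type*} [MeasurableSpace Ω] (P : Measure Ω) [IsProbabilityMeasure P]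
    -- the reserve with dependent phase-type claims
    (u c : ℝ) (hu : 0 ≤ u) (hc : 0 < c)
    (lam : ℝ≥0) (hlam : 0 < lam) (N : ℝ≥0 → Ω → ℕ) (hN : IsPoissonProcess lam N P)
    (M : PhaseTypeRep) (Y : ℕ → Ω → ℝ)
    (hY : ∀ n : ℕ, 1 ≤ n → IsMultivariatePhaseType M n (fun ω k => Y k ω) P)
    (hYN : ∀ n : ℕ, 1 ≤ n →
      IndepFun (fun ω (k : Fin n) => Y k ω) (fun ω (t : ℝ≥0) => N t ω) P)
    -- bounded dimensions, exit rates and dominant eigenvalues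
    (p : ℕ) (hp : ∀ k, M.dim k ≤ p)
    (ν : ℝ) (hν : ∀ k i, -(∑ j, M.A k i j) ≤ ν)
    (σ : ℝ) (hσ : 0 < σ) (hA : ∀ k z, IsDominantEigenvalue (M.A k) z → z.re ≤ -σ)
    -- i.i.d. exponential claims of rate `ν`, independent of the arrivals
    (L : ℕ → Ω → ℝ) (hLlaw : ∀ k, HasLaw (L k) (expMeasure ν) P) (hL : iIndepFun L P)
    (hLN : IndepFun (fun ω k => L k ω) (fun ω (t : ℝ≥0) => N t ω) P)
    -- i.i.d. Erlang claims with `p` stages of rate `σ`, independent of the arrivals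
    (H : ℕ → Ω → ℝ) (hHlaw : ∀ k, HasLaw (H k) (gammaMeasure p σ) P) (hH : iIndepFun H P)
    (hHN : IndepFun (fun ω k => H k ω) (fun ω (t : ℝ≥0) => N t ω) P) :
    P (ultimateRuin (reserve u c N L)) ≤ P (ultimateRuin (reserve u c N Y)) ∧
      P (ultimateRuin (reserve u c N Y)) ≤ P (ultimateRuin (reserve u c N H)) :=
  mainTheorem8_general hu hc.le hN.measurable hN.right_continuous hY hYN hp hν hσ hA hLlaw hL hLN
    hHlaw hH hHN
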